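/- **Setting.** Let $m$ be Lebesgue measure on $[0,1]$ and $L^0$ the space of real-valued measurable functions on $[0,1]$, with functions that agree a.e. identified. Let $p\in L^0$ with $p\ge 1$ a.e. For $f\in L^0$ consider the equation $$\varphi'(t)=\frac{|f(t)|^{p(t)}}{p(t)}\,\varphi(t)^{1-p(t)}\quad\text{for a.e. } t\in[0,1].\qquad(*)$$ A solution of $(*)$ with $\varphi(0)=a$ is an absolutely continuous $\varphi\colon[0,1]\to[0,\infty)$ such that $t\mapsto \frac{|f(t)|^{p(t)}}{p(t)}\varphi(t)^{1-p(t)}$ is integrable and $\varphi(T)=a+\int_0^T\frac{|f(t)|^{p(t)}}{p(t)}\varphi(t)^{1-p(t)}\,dt$ for all $T\in[0,1]$. We say that $\varphi_f$ exists if $(*)$ has a solution $\varphi_{f,a}$ with $\varphi_{f,a}(0)=a$ for every $a>0$ (it is then unique), and the pointwise limit $\varphi_f=\lim_{a\searrow0}\varphi_{f,a}$ is itself a solution of $(*)$ with $\varphi_f(0)=0$ (the integrand is read as $0$ where $\varphi_f=0$; there $f=0$ a.e.). Put $$L^{p(\cdot)}=\{f\in L^0:\varphi_f\text{ exists}\},\qquad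 \|f\|_{L^{p(\cdot)}}=\varphi_f(1),$$ with $\|f\|_{L^{p(\cdot)}}=\infty$ if $f\notin L^{p(\cdot)}$, and $$N(f)=\sup_{n\in\mathbb N}\big\|1_{\{p(\cdot)\le n\}}f\big\|_{L^{p(\cdot)}},\qquad \tilde L^{p(\cdot)}=\{f\in L^0:N(f)<\infty\}.$$ **Theorem 1.3.** Assume that there is a family $\Gamma$ of mutually disjoint nonempty open intervals $I\subset(0,1)$ such that 1. for each $I\in\Gamma$ the exponent $p(\cdot)$ is essentially bounded on $I$; 2. $m(\bigcup\Gamma)=1$; 3. for each $\Gamma_0\subset\Gamma$ with $s=\sup\bigcup\Gamma_0<1$, or $s=0$ (with $\sup\emptyset=0$), there is $I\in\Gamma$ such that $\inf I=s$. Then $L^{p(\cdot)}=\tilde L^{p(\cdot)}$, as sets and with $\|f\|_{L^{p(\cdot)}}=N(f)$ for every $f$ in this space. In particular $L^{p(\cdot)}$ is a linear subspace of $L^0$, $\|\cdot\|_{L^{p(\cdot)}}$ is a norm on it, and with this norm it is a Banach space. -/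

import Mathlib

open MeasureTheory Set Filter Topology
open scoped ENNReal

noncomputable section

/-- Lebesgue measure on the unit interval. -/
abbrev unitMeasure : Measure ℝ := volume.restrict (Icc (0 : ℝ) 1)

/-- The space `L⁰` of real measurable functions on `[0,1]`, modulo equality almost everywhere,
with its pointwise a.e. linear structure. -/
abbrev LZero : Type := ℝ →ₘ[unitMeasure] ℝ

/-- Right-hand side of the norm-determining equation:
`Θ(x, t) = |f(t)| ^ p(t) / p(t) * x ^ (1 - p(t))`. -/
def odeField (p f : ℝ → ℝ) (x t : ℝ) : ℝ :=
  |f t| ^ p t / p t * x ^ (1 - p t)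

/-- `φ : [0,1] → [0,∞)` is a solution, in the sense of Carathéodory, of
`φ(0) = a`, `φ'(t) = Θ(φ(t), t)` for a.e. `t ∈ [0,1]`. Only the values of `φ` on `[0,1]` matter. -/
structure IsCaratheodorySolution (p f : ℝ → ℝ) (a : ℝ) (φ : ℝ → ℝ) : Prop where
  nonneg : ∀ t ∈ Icc (0 : ℝ) 1, 0 ≤ φ t
  absolutelyContinuous : AbsolutelyContinuousOnInterval φ 0 1
  integrable : IntervalIntegrable (fun t => odeField p f (φ t) t) volume 0 1
  eq_integral : ∀ T ∈ Icc (0 : ℝ) 1, φ T = a + ∫ t in (0 : ℝ)..T, odeField p f (φ t) t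

/-- `φ` is the stabilized solution, i.e. the solution with `φ(0) = 0⁺`: for every initial value
`a > 0` the equation has a solution (which is then unique, since `Θ` is nonincreasing in `x > 0`),
these solutions converge pointwise to `φ` as `a ↘ 0`, and `φ` is again an absolutely continuous
solution, with `φ(0) = 0`. The value given to `0 ^ (1 - p(t))` plays no role here: for `p ≥ 1` a
solution with positive initial value is nondecreasing and, while it stays below `1`, it is at least
`∫₀ᵗ |f| ^ p / p`, so that `f = 0` a.e. on the set where the limit `φ` vanishes. In particular
`φ` is unique on `[0,1]`. -/
def IsStabilizedSolution (p f φ : ℝ → ℝ) : Prop :=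
  (∃ ψ : ℝ → ℝ → ℝ,
    (∀ a : ℝ, 0 < a → IsCaratheodorySolution p f a (ψ a)) ∧
    ∀ t ∈ Icc (0 : ℝ) 1, Tendsto (fun a => ψ a t) (𝓝[>] 0) (𝓝 (φ t))) ∧
  IsCaratheodorySolution p f 0 φ

/-- The ODE-determined norm: `φ_f(1)` if the stabilized solution `φ_f` exists, and `∞` otherwise.
(The stabilized solution is unique on `[0,1]`, so the infimum is over at most one value.) -/
def odeENorm (p f : ℝ → ℝ) : ℝ≥0∞ :=
  ⨅ (φ : ℝ → ℝ) (_ : IsStabilizedSolution p f φ), ENNReal.ofReal (φ 1)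

/-- The class `L^{p(·)}` of those `f ∈ L⁰` for which the stabilized solution exists. -/
def VarLp (p : ℝ → ℝ) : Set LZero :=
  {f | ∃ φ : ℝ → ℝ, IsStabilizedSolution p f φ}

/-- `N(f) = sup_n ‖1_{p(·) ≤ n} f‖`. -/
def extENorm (p f : ℝ → ℝ) : ℝ≥0∞ :=
  ⨆ n : ℕ, odeENorm p ({t | p t ≤ (n : ℝ)}.indicator f)

/-- The extended class of those `f ∈ L⁰` with `N(f) < ∞`. -/
def VarLpExt (p : ℝ → ℝ) : Set LZero :=
  {f | extENorm p f < ∞}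

/-- `ν` is a norm on the real vector space `E` for which `E` is complete. -/
def IsBanachNorm {E : Type*} [AddCommGroup E] [Module ℝ E] (ν : E → ℝ) : Prop :=
  letI : Norm E := ⟨ν⟩
  ∃ core : NormedSpace.Core ℝ E,
    letI : NormedAddCommGroup E := NormedAddCommGroup.ofCore core
    CompleteSpace E

end

/-! The field Θ(x,t) is nonincreasing in x > 0, nondecreasing in |f|, and is the perspective of the
convex function u ↦ u^p/p. Monotonicity in x gives comparison with supersolutions
(`IsCaratheodorySolution.le_supersolution`), hence φ_a ≤ φ_b ≤ φ_a + (b - a) for 0 < a ≤ b. So the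
stabilized solution exists as soon as all positive initial value problems are solvable, and ‖f‖ ≤ M
is equivalent to `SolutionBound p f M`: every such solution exists and grows by at most M
(`odeENorm_le_ofReal_iff`). All further work is done with this predicate.

If f lives on {p ≤ n} and Θ(a,·) is integrable, Θ is Lipschitz in x ≥ a with an integrable constant,
so the problem starting at a is solvable. Comparison then shows that truncation to {p ≤ n} does not
increase the bound, which is N(f) ≤ ‖f‖.

The converse is the Fatou property `SolutionBound.of_tendsto`. Solutions φ_k for the truncations
increase to some Φ, and Fatou's lemma gives only ∫₀ᵗ Θ(Φ(r),r) dr ≤ Φ(t) - a. The danger is growth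
of Φ that the integral does not see. By condition 3 every T in [0,1) lies in [a,b) for some (a,b) in
Γ (`exists_mem_Ico_of_wellOrdered`), so p is essentially bounded just to the right of T. There Θ at
the lowest and highest possible values of the solution differ by a bounded factor, dominated
convergence applies, and no growth is lost. Lower semicontinuity of Φ handles limits from the left,
and real induction carries the integral equation from 0 to 1 (`eq_integral_of_local`).

The triangle inequality holds because the perspective is jointly subadditive: the sum of solutions
for f and g is a supersolution for f + g. For completeness, a bound M controls the L¹ norm by 2M +
1, so absolutely convergent series converge a.e., and the Fatou property bounds their remainders. -/

noncomputable section

/-! ### Pointwise inequalities for the right-hand side -/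

section Field

variable {p f g : ℝ → ℝ} {t x y : ℝ}

lemma odeField_nonneg (hp : 1 ≤ p t) (hx : 0 ≤ x) : 0 ≤ odeField p f x t := by
  unfold odeField
  have : 0 ≤ p t := by linarith
  positivity

lemma odeField_anti (hp : 1 ≤ p t) (hx : 0 < x) (hxy : x ≤ y) :
    odeField p f y t ≤ odeField p f x t := by
  unfold odeField
  have h0 : 0 ≤ p t := by linarith
  have := Real.rpow_le_rpow_of_nonpos hx hxy (by linarith : 1 - p t ≤ 0)
  gcongr

lemma odeField_mono (hp : 1 ≤ p t) (hx : 0 ≤ x) (hfg : |f t| ≤ |g t|) :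
    odeField p f x t ≤ odeField p g x t := by
  unfold odeField
  have h0 : 0 ≤ p t := by linarith
  gcongr

lemma odeField_of_eq_zero (hp : 1 ≤ p t) (hf : f t = 0) : odeField p f x t = 0 := by
  unfold odeField
  rw [hf, abs_zero, Real.zero_rpow (by linarith)]
  simp

lemma eq_zero_of_odeField_eq_zero (hp : 1 ≤ p t) (hx : 0 < x) (h : odeField p f x t = 0) :
    f t = 0 := by
  by_contra hf
  have h1 : 0 < |f t| ^ p t := Real.rpow_pos_of_pos (abs_pos.2 hf) _
  have h2 : 0 < x ^ (1 - p t) := Real.rpow_pos_of_pos hx _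
  have h3 : 0 < p t := by linarith
  have : 0 < odeField p f x t := by unfold odeField; positivity
  exact this.ne' h

/-- The field is the perspective of `u ↦ u ^ p / p`. -/
lemma odeField_eq_mul (hx : 0 < x) : odeField p f x t = x * ((|f t| / x) ^ p t / p t) := by
  unfold odeField
  rw [Real.div_rpow (abs_nonneg _) hx.le, Real.rpow_sub hx, Real.rpow_one]
  ring

/-- Joint subadditivity of a perspective: (|f| + |g|)/(x + y) is the convex combination of |f|/x and
|g|/y with weights x/(x + y) and y/(x + y). This is the source of the triangle inequality. -/
lemma odeField_add_le (hp : 1 ≤ p t) (hx : 0 < x) (hy : 0 < y) :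
    odeField p (f + g) (x + y) t ≤ odeField p f x t + odeField p g y t := by
  have hxy : 0 < x + y := add_pos hx hy
  have h0 : 0 < p t := by linarith
  rw [odeField_eq_mul hxy, odeField_eq_mul hx, odeField_eq_mul hy]
  have hc := (convexOn_rpow hp).2
    (mem_Ici.2 (by positivity : 0 ≤ |f t| / x)) (mem_Ici.2 (by positivity : 0 ≤ |g t| / y))
    (by positivity : 0 ≤ x / (x + y)) (by positivity : 0 ≤ y / (x + y)) (by field_simp)
  simp only [smul_eq_mul] at hc
  have hle : |(f + g) t| / (x + y) ≤ x / (x + y) * (|f t| / x) + y / (x + y) * (|g t| / y) := by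
    have : x / (x + y) * (|f t| / x) + y / (x + y) * (|g t| / y) = (|f t| + |g t|) / (x + y) := by
      field_simp
    rw [this]
    gcongr
    exact abs_add_le _ _
  have h2 := (Real.rpow_le_rpow (by positivity) hle h0.le).trans hc
  calc (x + y) * ((|(f + g) t| / (x + y)) ^ p t / p t)
      ≤ (x + y) * ((x / (x + y) * (|f t| / x) ^ p t + y / (x + y) * (|g t| / y) ^ p t) / p t) := by
        gcongr
    _ = _ := by field_simp

lemma odeField_smul {c : ℝ} (hc : c ≠ 0) (hx : 0 < x) :
    odeField p (c • f) (|c| * x) t = |c| * odeField p f x t := by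
  have hc' : 0 < |c| := abs_pos.2 hc
  rw [odeField_eq_mul (by positivity), odeField_eq_mul hx, Pi.smul_apply, smul_eq_mul, abs_mul,
    mul_div_mul_left _ _ hc'.ne']
  ring

/-- The values at y and x have ratio (x/y)^p · (y/x), and Bernoulli's inequality bounds (x/y)^p from
below. The resulting Lipschitz constant is what Grönwall's lemma uses. -/
lemma odeField_sub_le (hp : 1 ≤ p t) (hx : 0 < x) (hxy : x ≤ y) :
    odeField p f x t - odeField p f y t ≤ p t / x * odeField p f x t * (y - x) := by
  have hy : 0 < y := hx.trans_le hxy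
  have hb := one_add_mul_self_le_rpow_one_add (s := x / y - 1)
    (by have : 0 < x / y := by positivity
        linarith) hp
  rw [add_sub_cancel] at hb
  have e : odeField p f y t = odeField p f x t * ((x / y) ^ p t * (y / x)) := by
    rw [odeField_eq_mul hy, odeField_eq_mul hx, Real.div_rpow (abs_nonneg _) hx.le,
      Real.div_rpow (abs_nonneg _) hy.le, Real.div_rpow hx.le hy.le]
    have := Real.rpow_pos_of_pos hx (p t)
    have := Real.rpow_pos_of_pos hy (p t)
    field_simp
  have h0 : 0 ≤ odeField p f x t := odeField_nonneg hp hx.le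
  have key : 1 - (x / y) ^ p t * (y / x) ≤ p t / x * (y - x) := by
    have h1 : (1 + p t * (x / y - 1)) * (y / x) ≤ (x / y) ^ p t * (y / x) := by gcongr
    have h2 : (1 + p t * (x / y - 1)) * (y / x) = y / x - p t / x * (y - x) := by
      field_simp
      ring
    have h3 : 1 ≤ y / x := by rwa [one_le_div hx]
    linarith
  rw [e]
  nlinarith

lemma abs_odeField_sub_le {n : ℝ} {a : ℝ} (hp : 1 ≤ p t) (hn : f t ≠ 0 → p t ≤ n) (ha : 0 < a)
    (hx : a ≤ x) (hy : a ≤ y) :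
    |odeField p f x t - odeField p f y t| ≤ n / a * odeField p f a t * |x - y| := by
  by_cases hf : f t = 0
  · simp [odeField_of_eq_zero hp hf]
  wlog hxy : x ≤ y generalizing x y
  · rw [abs_sub_comm, abs_sub_comm x y]
    exact this hy hx (le_of_not_ge hxy)
  have hx0 : 0 < x := ha.trans_le hx
  have hnn : 0 ≤ n := by linarith [hn hf]
  have h0 : 0 ≤ odeField p f x t := odeField_nonneg hp hx0.le
  rw [abs_of_nonneg (sub_nonneg.2 (odeField_anti hp hx0 hxy)), abs_sub_comm,
    abs_of_nonneg (sub_nonneg.2 hxy)]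
  refine (odeField_sub_le hp hx0 hxy).trans ?_
  have := odeField_anti (f := f) hp ha hx
  have := hn hf
  have : 0 ≤ y - x := sub_nonneg.2 hxy
  gcongr

/-- A Harnack-type bound: the exact ratio is (y/x)^(p - 1), which a bound on p makes uniform in t.
It reverses the monotonicity in x up to a constant and supplies the dominating functions. -/
lemma odeField_le_mul {n : ℝ} (hp : 1 ≤ p t) (hn : f t ≠ 0 → p t ≤ n) (hx : 0 < x) (hxy : x ≤ y) :
    odeField p f x t ≤ (y / x) ^ n * odeField p f y t := by
  by_cases hf : f t = 0
  · simp [odeField_of_eq_zero hp hf]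
  have hy := hx.trans_le hxy
  have h0 : 0 ≤ odeField p f y t := odeField_nonneg hp hy.le
  have e : odeField p f x t = (y / x) ^ (p t - 1) * odeField p f y t := by
    rw [odeField, odeField, Real.div_rpow hy.le hx.le, ← neg_sub (p t) 1, Real.rpow_neg hx.le,
      Real.rpow_neg hy.le]
    have := Real.rpow_pos_of_pos hx (p t - 1)
    have := Real.rpow_pos_of_pos hy (p t - 1)
    field_simp
  rw [e]
  have := hn hf
  have h3 : 1 ≤ y / x := by rwa [one_le_div hx]
  gcongr
  linarith

/-- Bernoulli gives u - 1 ≤ u^p/p, applied with u = |f|/x. Integrated along a solution, this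
controls the L¹ norm of f. -/
lemma abs_le_odeField_add (hp : 1 ≤ p t) (hx : 0 < x) : |f t| ≤ odeField p f x t + x := by
  rw [odeField_eq_mul hx]
  have h0 : 0 < p t := by linarith
  have hu : 0 ≤ |f t| / x := by positivity
  have hb := one_add_mul_self_le_rpow_one_add (s := |f t| / x - 1) (by linarith) hp
  rw [add_sub_cancel] at hb
  have h1 : |f t| / x - 1 ≤ (|f t| / x) ^ p t / p t := by
    rw [le_div_iff₀ h0]
    linarith
  have h2 : x * (|f t| / x - 1) ≤ x * ((|f t| / x) ^ p t / p t) := by gcongr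
  have h3 : x * (|f t| / x - 1) = |f t| - x := by field_simp
  linarith

lemma tendsto_odeField {ι : Type*} {l : Filter ι} {F : ι → ℝ → ℝ} {X : ι → ℝ} (hp : 1 ≤ p t)
    (hF : Tendsto (fun k => |F k t|) l (𝓝 |f t|)) (hX : Tendsto X l (𝓝 x)) (hx : 0 < x) :
    Tendsto (fun k => odeField p (F k) (X k) t) l (𝓝 (odeField p f x t)) := by
  unfold odeField
  exact ((hF.rpow_const (Or.inr (by linarith))).div_const _).mul (hX.rpow_const (Or.inl hx.ne'))

lemma Measurable.odeField {φ : ℝ → ℝ} (hp : Measurable p) (hf : Measurable f)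
    (hφ : Measurable φ) : Measurable fun t => odeField p f (φ t) t := by
  unfold _root_.odeField
  fun_prop

end Field

/-! ### Integrals over subintervals of [0,1], and Fatou's lemma -/

section UnitInterval

variable {F G : ℝ → ℝ} {s t : ℝ}

lemma intervalIntegrable_zero_one_iff :
    IntervalIntegrable F volume 0 1 ↔ Integrable F unitMeasure :=
  intervalIntegrable_iff_integrableOn_Icc_of_le zero_le_one

lemma MeasureTheory.Integrable.intervalIntegrable_of_unit (hF : Integrable F unitMeasure)
    (hs : s ∈ Icc (0 : ℝ) 1) (ht : t ∈ Icc (0 : ℝ) 1) : IntervalIntegrable F volume s t :=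
  (intervalIntegrable_zero_one_iff.2 hF).mono_set <| by
    rw [uIcc_of_le zero_le_one]
    exact uIcc_subset_Icc hs ht

lemma ae_restrict_Ioc_of_unit {P : ℝ → Prop} (h : ∀ᵐ r ∂unitMeasure, P r) (hs : 0 ≤ s)
    (ht : t ≤ 1) : ∀ᵐ r ∂(volume.restrict (Ioc s t)), P r :=
  ae_mono (Measure.restrict_mono
    (show Ioc s t ⊆ Icc (0 : ℝ) 1 from fun _ hr => ⟨hs.trans hr.1.le, hr.2.trans ht⟩) le_rfl) h

lemma integral_sub_of_unit (hF : Integrable F unitMeasure)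
    (hs : s ∈ Icc (0 : ℝ) 1) (ht : t ∈ Icc (0 : ℝ) 1) :
    (∫ r in (0 : ℝ)..t, F r) - ∫ r in (0 : ℝ)..s, F r = ∫ r in s..t, F r :=
  intervalIntegral.integral_interval_sub_left
    (hF.intervalIntegrable_of_unit (left_mem_Icc.2 zero_le_one) ht)
    (hF.intervalIntegrable_of_unit (left_mem_Icc.2 zero_le_one) hs)

lemma integral_le_of_unit (hF : Integrable F unitMeasure) (hG : Integrable G unitMeasure)
    (hs : s ∈ Icc (0 : ℝ) 1) (ht : t ∈ Icc (0 : ℝ) 1) (hst : s ≤ t)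
    (h : ∀ᵐ r ∂unitMeasure, r ∈ Ioc s t → F r ≤ G r) :
    ∫ r in s..t, F r ≤ ∫ r in s..t, G r := by
  rw [intervalIntegral.integral_of_le hst, intervalIntegral.integral_of_le hst]
  refine setIntegral_mono_ae_restrict (hF.intervalIntegrable_of_unit hs ht).1
    (hG.intervalIntegrable_of_unit hs ht).1 ?_
  filter_upwards [ae_restrict_Ioc_of_unit h hs.1 ht.2, ae_restrict_mem measurableSet_Ioc]
    with r hr hm using hr hm

lemma integral_nonneg_of_unit (hs : s ∈ Icc (0 : ℝ) 1)
    (ht : t ∈ Icc (0 : ℝ) 1) (hst : s ≤ t) (h : ∀ᵐ r ∂unitMeasure, 0 ≤ F r) :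
    0 ≤ ∫ r in s..t, F r := by
  rw [intervalIntegral.integral_of_le hst]
  exact integral_nonneg_of_ae (ae_restrict_Ioc_of_unit h hs.1 ht.2)

lemma integral_unitMeasure : ∫ r, F r ∂unitMeasure = ∫ r in (0 : ℝ)..1, F r := by
  rw [intervalIntegral.integral_of_le zero_le_one, integral_Icc_eq_integral_Ioc]

lemma setIntegral_Iic_unitMeasure (ht : t ∈ Icc (0 : ℝ) 1) :
    ∫ r in Iic t, F r ∂unitMeasure = ∫ r in (0 : ℝ)..t, F r := by
  rw [intervalIntegral.integral_of_le ht.1, Measure.restrict_restrict measurableSet_Iic,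
    ← integral_Icc_eq_integral_Ioc]
  congr 2
  ext r
  simp only [mem_inter_iff, mem_Iic, mem_Icc]
  exact ⟨fun h => ⟨h.2.1, h.1⟩, fun h => ⟨h.2, h.1, h.2.trans ht.2⟩⟩

/-- Fatou's lemma for nonnegative integrable functions whose integrals have convergent bounds. -/
lemma integrable_and_integral_le_of_tendsto {H : ℕ → ℝ → ℝ} {μ : Measure ℝ} {c : ℕ → ℝ} {C : ℝ}
    (hH : ∀ k, Integrable (H k) μ) (h0 : ∀ k, ∀ᵐ r ∂μ, 0 ≤ H k r)
    (hc : ∀ k, ∫ r, H k r ∂μ ≤ c k) (hC : Tendsto c atTop (𝓝 C))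
    (hlim : ∀ᵐ r ∂μ, Tendsto (fun k => H k r) atTop (𝓝 (F r))) :
    Integrable F μ ∧ ∫ r, F r ∂μ ≤ C := by
  have hC0 : 0 ≤ C := ge_of_tendsto' hC fun k => (integral_nonneg_of_ae (h0 k)).trans (hc k)
  have hle : liminf (fun k => ∫⁻ r, ‖H k r‖ₑ ∂μ) atTop ≤ ENNReal.ofReal C := by
    rw [← (ENNReal.tendsto_ofReal hC).liminf_eq]
    refine liminf_le_liminf (Eventually.of_forall fun k => ?_)
    rw [← ofReal_integral_norm_eq_lintegral_enorm (hH k)]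
    refine ENNReal.ofReal_le_ofReal (le_of_eq_of_le (integral_congr_ae ?_) (hc k))
    filter_upwards [h0 k] with r hr using Real.norm_of_nonneg hr
  have hi : Integrable F μ := integrable_of_tendsto hlim (fun k => (hH k).1)
    (ne_top_of_le_ne_top ENNReal.ofReal_ne_top hle)
  refine ⟨hi, ?_⟩
  have h1 :=
    (lintegral_enorm_le_liminf_of_tendsto hlim fun k => (hH k).1.aemeasurable.enorm).trans hle
  rw [← ofReal_integral_norm_eq_lintegral_enorm hi, ENNReal.ofReal_le_ofReal_iff hC0] at h1
  exact (integral_mono hi hi.norm fun r => Real.le_norm_self _).trans h1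

end UnitInterval

/-! ### Solutions and comparison -/

section Solution

variable {p f g φ ψ : ℝ → ℝ} {a b s t : ℝ}

namespace IsCaratheodorySolution

lemma mk_of_integrable (h0 : ∀ t ∈ Icc (0 : ℝ) 1, 0 ≤ φ t)
    (hi : Integrable (fun t => odeField p f (φ t) t) unitMeasure)
    (h : ∀ T ∈ Icc (0 : ℝ) 1, φ T = a + ∫ t in (0 : ℝ)..T, odeField p f (φ t) t) :
    IsCaratheodorySolution p f a φ where
  nonneg := h0
  absolutelyContinuous := by
    have hi' := intervalIntegrable_zero_one_iff.2 hi
    have h1 := hi'.absolutelyContinuousOnInterval_intervalIntegral (c := 0) (by simp)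
    rw [absolutelyContinuousOnInterval_iff] at h1 ⊢
    intro ε hε
    obtain ⟨δ, hδ, H⟩ := h1 ε hε
    refine ⟨δ, hδ, fun E hE hlt => ?_⟩
    have := H E hE hlt
    refine lt_of_eq_of_lt (Finset.sum_congr rfl fun i hi => ?_) this
    have hE' := hE.1 i hi
    rw [uIcc_of_le zero_le_one] at hE'
    rw [h _ hE'.1, h _ hE'.2, dist_add_left]
  integrable := intervalIntegrable_zero_one_iff.2 hi
  eq_integral := h

lemma integrable_unit (h : IsCaratheodorySolution p f a φ) :
    Integrable (fun t => odeField p f (φ t) t) unitMeasure :=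
  intervalIntegrable_zero_one_iff.1 h.integrable

lemma congr {p' f' : ℝ → ℝ} (h : IsCaratheodorySolution p f a φ) (hp : p =ᵐ[unitMeasure] p')
    (hf : f =ᵐ[unitMeasure] f') : IsCaratheodorySolution p' f' a φ := by
  have e : (fun t => odeField p f (φ t) t) =ᵐ[unitMeasure] fun t => odeField p' f' (φ t) t := by
    filter_upwards [hp, hf] with t h1 h2
    rw [odeField, odeField, h1, h2]
  refine mk_of_integrable h.nonneg (h.integrable_unit.congr e) fun T hT => ?_
  rw [h.eq_integral T hT, intervalIntegral.integral_of_le hT.1,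
    intervalIntegral.integral_of_le hT.1,
    integral_congr_ae (ae_restrict_Ioc_of_unit e le_rfl hT.2)]

lemma sub_eq (h : IsCaratheodorySolution p f a φ) (hs : s ∈ Icc (0 : ℝ) 1)
    (ht : t ∈ Icc (0 : ℝ) 1) : φ t - φ s = ∫ r in s..t, odeField p f (φ r) r := by
  rw [← integral_sub_of_unit h.integrable_unit hs ht, h.eq_integral t ht, h.eq_integral s hs]
  ring

lemma apply_zero (h : IsCaratheodorySolution p f a φ) : φ 0 = a := by
  rw [h.eq_integral 0 (left_mem_Icc.2 zero_le_one)]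
  simp

lemma continuousOn (h : IsCaratheodorySolution p f a φ) : ContinuousOn φ (Icc 0 1) := by
  have := h.absolutelyContinuous.continuousOn
  rwa [uIcc_of_le zero_le_one] at this

lemma mono (h : IsCaratheodorySolution p f a φ) (hp : ∀ t, 1 ≤ p t) (hs : s ∈ Icc (0 : ℝ) 1)
    (ht : t ∈ Icc (0 : ℝ) 1) (hst : s ≤ t) : φ s ≤ φ t := by
  rw [← sub_nonneg, h.sub_eq hs ht]
  refine integral_nonneg_of_unit hs ht hst ?_
  filter_upwards [ae_restrict_mem measurableSet_Icc] with r hr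
  exact odeField_nonneg (hp r) (h.nonneg r hr)

lemma le_apply (h : IsCaratheodorySolution p f a φ) (hp : ∀ t, 1 ≤ p t)
    (ht : t ∈ Icc (0 : ℝ) 1) : a ≤ φ t := by
  rw [← h.apply_zero]
  exact h.mono hp (left_mem_Icc.2 zero_le_one) ht ht.1

lemma apply_le (h : IsCaratheodorySolution p f a φ) (hp : ∀ t, 1 ≤ p t)
    (ht : t ∈ Icc (0 : ℝ) 1) : φ t ≤ φ 1 :=
  h.mono hp ht (right_mem_Icc.2 zero_le_one) ht.2

lemma integral_unit (h : IsCaratheodorySolution p f a φ) :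
    ∫ r, odeField p f (φ r) r ∂unitMeasure = φ 1 - a := by
  rw [integral_unitMeasure, h.eq_integral 1 (right_mem_Icc.2 zero_le_one)]
  ring

/-- Comparison of a solution with a positive supersolution. -/
lemma le_supersolution (hφ : IsCaratheodorySolution p f a φ) (hp : ∀ t, 1 ≤ p t)
    (hψc : ContinuousOn ψ (Icc 0 1)) (hψ0 : ∀ t ∈ Icc (0 : ℝ) 1, 0 < ψ t) (ha : a ≤ ψ 0)
    {h : ℝ → ℝ} (hh : Integrable h unitMeasure)
    (hψ : ∀ s ∈ Icc (0 : ℝ) 1, ∀ t ∈ Icc (0 : ℝ) 1, s ≤ t → ∫ r in s..t, h r ≤ ψ t - ψ s)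
    (hle : ∀ᵐ t ∂unitMeasure, odeField p f (ψ t) t ≤ h t) (ht : t ∈ Icc (0 : ℝ) 1) :
    φ t ≤ ψ t := by
  by_contra! hlt
  have hsub : Icc 0 t ⊆ Icc (0 : ℝ) 1 := Icc_subset_Icc_right ht.2
  -- After the last time s with φ ≤ ψ, the solution is the larger one, so its slope is at most
  -- Θ(ψ(r),r) ≤ h(r). Hence φ - ψ cannot increase on [s,t].
  let S := {r ∈ Icc 0 t | φ r ≤ ψ r}
  have hSc : IsCompact S := isCompact_Icc.of_isClosed_subset
    (isClosed_Icc.isClosed_le (hφ.continuousOn.mono hsub) (hψc.mono hsub)) fun r hr => hr.1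
  have hS0 : (0 : ℝ) ∈ S := ⟨⟨le_rfl, ht.1⟩, by rw [hφ.apply_zero]; exact ha⟩
  have hs := hSc.sSup_mem ⟨0, hS0⟩
  set s := sSup S
  have hs1 := hsub hs.1
  have key : ∀ r ∈ Ioc s t, ψ r ≤ φ r := by
    intro r hr
    by_contra! h'
    exact absurd (le_csSup hSc.bddAbove (show r ∈ S from ⟨⟨hs.1.1.trans hr.1.le, hr.2⟩, h'.le⟩))
      (not_le.2 hr.1)
  have h1 : φ t - φ s ≤ ∫ r in s..t, h r := by
    rw [hφ.sub_eq hs1 ht]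
    refine integral_le_of_unit hφ.integrable_unit hh hs1 ht hs.1.2 ?_
    filter_upwards [hle, ae_restrict_mem measurableSet_Icc] with r hr hrm hr'
    exact (odeField_anti (hp r) (hψ0 r hrm) (key r hr')).trans hr
  have h2 := hψ s hs1 t ht hs.1.2
  have h3 := hs.2
  linarith

lemma le_of_le (hφ : IsCaratheodorySolution p f a φ) (hψ : IsCaratheodorySolution p g b ψ)
    (hp : ∀ t, 1 ≤ p t) (hb : 0 < b) (hab : a ≤ b) (hfg : ∀ᵐ t ∂unitMeasure, |f t| ≤ |g t|)
    (ht : t ∈ Icc (0 : ℝ) 1) : φ t ≤ ψ t := by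
  have h0 : ∀ t ∈ Icc (0 : ℝ) 1, 0 < ψ t := fun t ht => hb.trans_le (hψ.le_apply hp ht)
  refine hφ.le_supersolution hp hψ.continuousOn h0 (by rwa [hψ.apply_zero]) hψ.integrable_unit
    (fun s hs t ht _ => (hψ.sub_eq hs ht).ge) ?_ ht
  filter_upwards [hfg, ae_restrict_mem measurableSet_Icc] with r hr hrm
  exact odeField_mono (hp r) (h0 r hrm).le hr

/-- The shift φ + (b - a) has the slope of φ but larger values, so it is a supersolution starting at
b. -/
lemma le_add (hφ : IsCaratheodorySolution p f a φ) (hψ : IsCaratheodorySolution p f b ψ)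
    (hp : ∀ t, 1 ≤ p t) (ha : 0 < a) (hab : a ≤ b) (ht : t ∈ Icc (0 : ℝ) 1) :
    ψ t ≤ φ t + (b - a) := by
  have h0 : ∀ t ∈ Icc (0 : ℝ) 1, 0 < φ t := fun t ht => ha.trans_le (hφ.le_apply hp ht)
  refine hψ.le_supersolution (ψ := fun t => φ t + (b - a)) hp
    (hφ.continuousOn.add continuousOn_const) (fun t ht => by linarith [h0 t ht])
    (by simp [hφ.apply_zero]) hφ.integrable_unit
    (fun s hs t ht _ => by rw [← hφ.sub_eq hs ht]; linarith) ?_ ht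
  filter_upwards [ae_restrict_mem measurableSet_Icc] with r hrm
  exact odeField_anti (hp r) (h0 r hrm) (by linarith)

end IsCaratheodorySolution

end Solution

/-- Grönwall's lemma with an integrable coefficient and zero initial value. -/
lemma eq_zero_of_le_integral_mul {l d : ℝ → ℝ} (hl : Integrable l unitMeasure)
    (hl0 : ∀ t, 0 ≤ l t) (hd : ContinuousOn d (Icc 0 1)) (hd0 : ∀ t ∈ Icc (0 : ℝ) 1, 0 ≤ d t)
    (h : ∀ t ∈ Icc (0 : ℝ) 1, d t ≤ ∫ r in (0 : ℝ)..t, l r * d r) :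
    ∀ t ∈ Icc (0 : ℝ) 1, d t = 0 := by
  have hld : Integrable (fun r => l r * d r) unitMeasure :=
    IntegrableOn.mul_continuousOn hl hd isCompact_Icc
  obtain ⟨K, hK⟩ := isCompact_Icc.bddAbove_image hd
  have hK' : ∀ t ∈ Icc (0 : ℝ) 1, d t ≤ K := fun t ht => hK (mem_image_of_mem d ht)
  -- Real induction: S contains 0, is closed in [0,1], and can be extended to the right.
  let S := {t : ℝ | ∀ r ∈ Icc 0 t, d r = 0}
  have h00 : (0 : ℝ) ∈ S := by
    intro r hr
    obtain rfl : r = 0 := le_antisymm hr.2 hr.1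
    have h1 := h 0 (left_mem_Icc.2 zero_le_one)
    rw [intervalIntegral.integral_same] at h1
    exact le_antisymm h1 (hd0 0 (left_mem_Icc.2 zero_le_one))
  suffices H : Icc (0 : ℝ) 1 ⊆ S from fun t ht => H ht t (right_mem_Icc.2 ht.1)
  refine IsClosed.Icc_subset_of_forall_exists_gt ?_ h00 ?_
  -- The right-hand side is closed and asks only for d = 0 on [0,t). The value at t follows, since
  -- the integrand in the hypothesis vanishes on [0,t).
  · have e : S ∩ Icc 0 1 = Icc 0 1 ∩ ⋂ r ∈ Icc (0 : ℝ) 1, {t | t ≤ r} ∪ {t | d r = 0} := by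
      ext t
      simp only [mem_inter_iff, mem_iInter, mem_union, mem_ofPred_eq, S]
      constructor
      · rintro ⟨h1, h2⟩
        refine ⟨h2, fun r hr => ?_⟩
        rcases le_or_gt r t with h3 | h3
        · exact Or.inr (h1 r ⟨hr.1, h3⟩)
        · exact Or.inl h3.le
      · rintro ⟨h1, h2⟩
        refine ⟨?_, h1⟩
        have hlt : ∀ r ∈ Ico 0 t, d r = 0 := fun r hr =>
          (h2 r ⟨hr.1, hr.2.le.trans h1.2⟩).resolve_left (not_le.2 hr.2)
        intro r hr
        rcases hr.2.eq_or_lt with rfl | h3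
        · refine le_antisymm ((h r h1).trans ?_) (hd0 r h1)
          rw [intervalIntegral.integral_of_le h1.1, ← integral_Ico_eq_integral_Ioc]
          refine (setIntegral_eq_zero_of_forall_eq_zero fun x hx => ?_).le
          rw [hlt x hx, mul_zero]
        · exact hlt r ⟨hr.1, h3⟩
    rw [e]
    refine isClosed_Icc.inter (isClosed_biInter fun r _ => isClosed_Iic.union ?_)
    by_cases hr : d r = 0 <;> simp [hr]
  · rintro x ⟨hxS, hx⟩ y hxy
    have hx1 : x ∈ Icc (0 : ℝ) 1 := ⟨hx.1, hx.2.le⟩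
    have hcont : ContinuousWithinAt (fun t => ∫ r in x..t, l r) (Icc x 1) x := by
      have := intervalIntegral.continuousOn_primitive_interval (f := l) (a := x) (b := 1)
        (μ := volume) (by
          rw [uIcc_of_le hx.2.le]
          exact IntegrableOn.mono_set hl (Icc_subset_Icc_left hx.1))
      rw [uIcc_of_le hx.2.le] at this
      exact this x (left_mem_Icc.2 hx.2.le)
    have hev : ∀ᶠ t in 𝓝[>] x, ∫ r in x..t, l r < 1 / 2 := by
      have h1 : Tendsto (fun t => ∫ r in x..t, l r) (𝓝[Icc x 1] x) (𝓝 0) := by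
        simpa [ContinuousWithinAt] using hcont
      have h2 := h1.mono_left (nhdsWithin_mono x (Ioc_subset_Icc_self (a := x) (b := 1)))
      rw [nhdsWithin_Ioc_eq_nhdsGT hx.2] at h2
      exact h2.eventually (gt_mem_nhds (by norm_num))
    obtain ⟨z, hz, hzy⟩ := (hev.and (Ioc_mem_nhdsGT (lt_min hxy hx.2))).exists
    have hz1 : z ∈ Icc (0 : ℝ) 1 := ⟨hx.1.trans hzy.1.le, hzy.2.trans (min_le_right _ _)⟩
    refine ⟨z, ?_, hzy.1, hzy.2.trans (min_le_left _ _)⟩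
    -- As l has integral below 1/2 over [x,z], each use of the integral inequality halves the bound
    -- on d.
    have hbound : ∀ k : ℕ, ∀ r ∈ Icc x z, d r ≤ K / 2 ^ k := by
      intro k
      induction k with
      | zero =>
        intro r hr
        simpa using hK' r ⟨hx.1.trans hr.1, hr.2.trans hz1.2⟩
      | succ k ih =>
        intro r hr
        have hr1 : r ∈ Icc (0 : ℝ) 1 := ⟨hx.1.trans hr.1, hr.2.trans hz1.2⟩
        have hKk : 0 ≤ K / 2 ^ k := (hd0 x hx1).trans (ih x (left_mem_Icc.2 hzy.1.le))
        have e0 : ∫ s in (0 : ℝ)..x, l s * d s = 0 := by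
          rw [intervalIntegral.integral_of_le hx.1]
          refine setIntegral_eq_zero_of_forall_eq_zero fun s hs => ?_
          rw [hxS s ⟨hs.1.le, hs.2⟩, mul_zero]
        calc d r ≤ ∫ s in (0 : ℝ)..r, l s * d s := h r hr1
          _ = ∫ s in x..r, l s * d s := by
            rw [← integral_sub_of_unit hld hx1 hr1, e0, sub_zero]
          _ ≤ ∫ s in x..r, l s * (K / 2 ^ k) := by
            refine integral_le_of_unit hld (hl.mul_const _) hx1 hr1 hr.1 (ae_of_all _ ?_)
            intro s hs
            exact mul_le_mul_of_nonneg_left (ih s ⟨hs.1.le, hs.2.trans hr.2⟩) (hl0 s)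
          _ = (∫ s in x..r, l s) * (K / 2 ^ k) := intervalIntegral.integral_mul_const _ _
          _ ≤ (1 / 2) * (K / 2 ^ k) := by
            refine mul_le_mul_of_nonneg_right (le_trans ?_ hz.le) hKk
            rw [← sub_nonneg, ← integral_sub_of_unit hl hx1 hz1,
              ← integral_sub_of_unit hl hx1 hr1, sub_sub_sub_cancel_right,
              integral_sub_of_unit hl hr1 hz1]
            exact integral_nonneg_of_unit hr1 hz1 hr.2 (ae_of_all _ hl0)
          _ = K / 2 ^ (k + 1) := by rw [pow_succ]; field_simp
    intro r hr
    rcases le_total r x with h1 | h1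
    · exact hxS r ⟨hr.1, h1⟩
    · refine le_antisymm ?_ (hd0 r ⟨hr.1, hr.2.trans hz1.2⟩)
      have hlim : Tendsto (fun k : ℕ => K / 2 ^ k) atTop (𝓝 0) :=
        tendsto_const_nhds.div_atTop (tendsto_pow_atTop_atTop_of_one_lt one_lt_two)
      exact ge_of_tendsto' hlim fun k => hbound k r ⟨h1, hr.2⟩

/-! ### Existence for bounded exponents by monotone iteration -/

section Existence

variable {p f : ℝ → ℝ} {a : ℝ}

/-- The integral operator `u ↦ a + ∫₀ᵗ Θ(u(s), s) ds`, as a function on the real line. -/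
def picardOp (p f : ℝ → ℝ) (a : ℝ) (u : ℝ → ℝ) (t : ℝ) : ℝ :=
  a + ∫ s in Iic t, odeField p f (u s) s ∂unitMeasure

variable {u v : ℝ → ℝ}

lemma integrable_odeField_of_le (hp : Measurable p) (hp1 : ∀ t, 1 ≤ p t) (hf : Measurable f)
    (ha : 0 < a) (hi : Integrable (odeField p f a) unitMeasure) (hu : Measurable u)
    (hau : ∀ t, a ≤ u t) : Integrable (fun t => odeField p f (u t) t) unitMeasure := by
  refine hi.mono' (hp.odeField hf hu).aestronglyMeasurable (ae_of_all _ fun t => ?_)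
  rw [Real.norm_of_nonneg (odeField_nonneg (hp1 t) (ha.le.trans (hau t)))]
  exact odeField_anti (hp1 t) ha (hau t)

lemma le_picardOp (hp1 : ∀ t, 1 ≤ p t) (hu : ∀ t, 0 ≤ u t) (t : ℝ) : a ≤ picardOp p f a u t :=
  le_add_of_nonneg_right (integral_nonneg fun s => odeField_nonneg (hp1 s) (hu s))

lemma picardOp_anti (hp : Measurable p) (hp1 : ∀ t, 1 ≤ p t) (hf : Measurable f) (ha : 0 < a)
    (hi : Integrable (odeField p f a) unitMeasure) (hu : Measurable u) (hv : Measurable v)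
    (hau : ∀ t, a ≤ u t) (huv : ∀ t, u t ≤ v t) (t : ℝ) :
    picardOp p f a v t ≤ picardOp p f a u t := by
  refine add_le_add_right (setIntegral_mono ?_ ?_ fun s =>
    odeField_anti (hp1 s) (ha.trans_le (hau s)) (huv s)) a
  · exact (integrable_odeField_of_le hp hp1 hf ha hi hv fun s => (hau s).trans (huv s)).integrableOn
  · exact (integrable_odeField_of_le hp hp1 hf ha hi hu hau).integrableOn

lemma monotone_picardOp (hp : Measurable p) (hp1 : ∀ t, 1 ≤ p t) (hf : Measurable f) (ha : 0 < a)
    (hi : Integrable (odeField p f a) unitMeasure) (hu : Measurable u) (hau : ∀ t, a ≤ u t) :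
    Monotone (picardOp p f a u) := fun _ _ hst =>
  add_le_add_right (setIntegral_mono_set
    (integrable_odeField_of_le hp hp1 hf ha hi hu hau).integrableOn
    (ae_of_all _ fun r => odeField_nonneg (hp1 r) (ha.le.trans (hau r)))
    (Iic_subset_Iic.2 hst).eventuallyLE) a

lemma tendsto_picardOp (hp : Measurable p) (hp1 : ∀ t, 1 ≤ p t) (hf : Measurable f) (ha : 0 < a)
    (hi : Integrable (odeField p f a) unitMeasure) {U : ℕ → ℝ → ℝ} (hU : ∀ k, Measurable (U k))
    (haU : ∀ k t, a ≤ U k t) (hlim : ∀ t, Tendsto (fun k => U k t) atTop (𝓝 (u t))) (t : ℝ) :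
    Tendsto (fun k => picardOp p f a (U k) t) atTop (𝓝 (picardOp p f a u t)) := by
  refine tendsto_const_nhds.add (tendsto_integral_of_dominated_convergence (odeField p f a)
    (fun k => (hp.odeField hf (hU k)).aestronglyMeasurable) hi.integrableOn
    (fun k => ae_of_all _ fun s => ?_) (ae_of_all _ fun s => ?_))
  · rw [Real.norm_of_nonneg (odeField_nonneg (hp1 s) (ha.le.trans (haU k s)))]
    exact odeField_anti (hp1 s) ha (haU k s)
  · exact tendsto_odeField (hp1 s) tendsto_const_nhds (hlim s)
      (ha.trans_le (ge_of_tendsto' (hlim s) fun k => haU k s))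

lemma continuousOn_picardOp (h : Integrable (fun t => odeField p f (u t) t) unitMeasure) :
    ContinuousOn (picardOp p f a u) (Icc 0 1) := by
  have h1 : ContinuousOn (fun t => a + ∫ s in (0 : ℝ)..t, odeField p f (u s) s) (Icc 0 1) := by
    have := intervalIntegral.continuousOn_primitive_interval (f := fun t => odeField p f (u t) t)
      (a := 0) (b := 1) (μ := volume) (by rwa [uIcc_of_le zero_le_one])
    rw [uIcc_of_le zero_le_one] at this
    exact continuousOn_const.add this
  exact h1.congr fun t ht => by rw [picardOp, setIntegral_Iic_unitMeasure ht]

/-- A pair of functions exchanged by the integral operator consists of equal functions. -/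
lemma eq_of_picardOp_eq (hp : Measurable p) (hp1 : ∀ t, 1 ≤ p t) (hf : Measurable f) (ha : 0 < a)
    (hi : Integrable (odeField p f a) unitMeasure) {n : ℝ} (hn0 : 0 ≤ n)
    (hn : ∀ t, f t ≠ 0 → p t ≤ n) (hu : Measurable u) (hv : Measurable v)
    (hau : ∀ t, a ≤ u t) (hav : ∀ t, a ≤ v t)
    (huv : picardOp p f a u = v) (hvu : picardOp p f a v = u) {t : ℝ} (ht : t ∈ Icc (0 : ℝ) 1) :
    u t = v t := by
  have hiu := integrable_odeField_of_le hp hp1 hf ha hi hu hau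
  have hiv := integrable_odeField_of_le hp hp1 hf ha hi hv hav
  have hcu : ContinuousOn u (Icc 0 1) := hvu ▸ continuousOn_picardOp hiv
  have hcv : ContinuousOn v (Icc 0 1) := huv ▸ continuousOn_picardOp hiu
  have hd : ContinuousOn (fun t => |u t - v t|) (Icc 0 1) := (hcu.sub hcv).abs
  have hl : Integrable (fun t => n / a * odeField p f a t) unitMeasure := hi.const_mul _
  have hld : Integrable (fun r => n / a * odeField p f a r * |u r - v r|) unitMeasure :=
    IntegrableOn.mul_continuousOn hl hd isCompact_Icc
  -- Since the operator exchanges u and v, u - v is an integral of Θ(v) - Θ(u), so the Lipschitz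
  -- bound yields a Grönwall inequality for |u - v|.
  have key := eq_zero_of_le_integral_mul hl
    (fun t => mul_nonneg (by positivity) (odeField_nonneg (hp1 t) ha.le)) hd
    (fun t _ => abs_nonneg _) (fun t ht => ?_) t ht
  · exact sub_eq_zero.1 (abs_eq_zero.1 key)
  have h0 : (0 : ℝ) ∈ Icc (0 : ℝ) 1 := left_mem_Icc.2 zero_le_one
  have e : u t - v t =
      ∫ r in (0 : ℝ)..t, (odeField p f (v r) r - odeField p f (u r) r) := by
    rw [intervalIntegral.integral_sub (hiv.intervalIntegrable_of_unit h0 ht)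
      (hiu.intervalIntegrable_of_unit h0 ht)]
    conv_lhs => rw [← congrFun hvu t, ← congrFun huv t]
    rw [picardOp, picardOp, setIntegral_Iic_unitMeasure ht, setIntegral_Iic_unitMeasure ht]
    ring
  rw [e]
  refine (intervalIntegral.abs_integral_le_integral_abs ht.1).trans ?_
  refine integral_le_of_unit (hiv.sub hiu).abs hld h0 ht ht.1 (ae_of_all _ fun r _ => ?_)
  rw [abs_sub_comm (u r)]
  exact abs_odeField_sub_le (hp1 r) (hn r) ha (hav r) (hau r)

theorem exists_isCaratheodorySolution (hp : Measurable p) (hp1 : ∀ t, 1 ≤ p t)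
    (hf : Measurable f) (ha : 0 < a) (hi : Integrable (odeField p f a) unitMeasure) {n : ℝ}
    (hn : ∀ t, f t ≠ 0 → p t ≤ n) : ∃ φ, IsCaratheodorySolution p f a φ := by
  wlog hn0 : 0 ≤ n generalizing n
  · exact this (n := max n 0) (fun t ht => (hn t ht).trans (le_max_left _ _)) (le_max_right _ _)
  set T := picardOp p f a
  have hTa : ∀ {w : ℝ → ℝ}, (∀ t, a ≤ w t) → ∀ t, a ≤ T w t := fun h =>
    le_picardOp hp1 fun t => ha.le.trans (h t)
  have hTm : ∀ {w : ℝ → ℝ}, Measurable w → (∀ t, a ≤ w t) → Measurable (T w) := fun hm h =>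
    (monotone_picardOp hp hp1 hf ha hi hm h).measurable
  -- The operator T is antitone, so T ∘ T is monotone. Its iterates from the least admissible
  -- function a increase to a fixed point u of T ∘ T, and T exchanges u and T u, which must then
  -- coincide.
  let W : ℕ → ℝ → ℝ := fun k => (fun w => T (T w))^[k] fun _ => a
  have hWs : ∀ k, W (k + 1) = T (T (W k)) := fun k => Function.iterate_succ_apply' _ _ _
  have hW : ∀ k, Measurable (W k) ∧ ∀ t, a ≤ W k t := by
    intro k
    induction k with
    | zero => exact ⟨measurable_const, fun t => le_rfl⟩
    | succ k ih =>
      rw [hWs]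
      exact ⟨hTm (hTm ih.1 ih.2) (hTa ih.2), hTa (hTa ih.2)⟩
  have hWmono : ∀ k t, W k t ≤ W (k + 1) t := by
    intro k
    induction k with
    | zero => exact (hW 1).2
    | succ k ih =>
      rw [hWs k, hWs (k + 1)]
      refine picardOp_anti hp hp1 hf ha hi (hTm (hW _).1 (hW _).2) (hTm (hW _).1 (hW _).2)
        (hTa (hW _).2) ?_
      exact picardOp_anti hp hp1 hf ha hi (hW _).1 (hW _).1 (hW _).2 ih
  have hWle : ∀ k t, W k t ≤ T (fun _ => a) t := by
    intro k t
    cases k with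
    | zero => exact hTa (fun _ => le_rfl) t
    | succ k =>
      rw [hWs]
      exact picardOp_anti hp hp1 hf ha hi measurable_const (hTm (hW _).1 (hW _).2)
        (fun _ => le_rfl) (hTa (hW k).2) t
  let u : ℝ → ℝ := fun t => ⨆ k, W k t
  have hu : ∀ t, Tendsto (fun k => W k t) atTop (𝓝 (u t)) := fun t =>
    tendsto_atTop_ciSup (monotone_nat_of_le_succ fun k => hWmono k t)
      ⟨_, forall_mem_range.2 fun k => hWle k t⟩
  have hum : Measurable u := measurable_of_tendsto_metrizable (fun k => (hW k).1)
    (tendsto_pi_nhds.2 hu)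
  have hau : ∀ t, a ≤ u t := fun t => ge_of_tendsto' (hu t) fun k => (hW k).2 t
  have h1 := tendsto_picardOp hp hp1 hf ha hi (fun k => (hW k).1) (fun k => (hW k).2) hu
  have h2 := tendsto_picardOp hp hp1 hf ha hi (fun k => hTm (hW k).1 (hW k).2)
    (fun k => hTa (hW k).2) h1
  have hTTu : T (T u) = u := by
    funext t
    refine tendsto_nhds_unique (h2 t) (((hu t).comp (tendsto_add_atTop_nat 1)).congr fun k => ?_)
    exact congrFun (hWs k) t
  have heq := fun t (ht : t ∈ Icc (0 : ℝ) 1) => eq_of_picardOp_eq hp hp1 hf ha hi hn0 hn hum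
    (hTm hum hau) hau (hTa hau) rfl hTTu ht
  refine ⟨u, .mk_of_integrable (fun t _ => ha.le.trans (hau t))
    (integrable_odeField_of_le hp hp1 hf ha hi hum hau) fun t ht => ?_⟩
  rw [heq t ht, ← setIntegral_Iic_unitMeasure ht]
  rfl

end Existence

/-! ### Solution bounds and their Fatou property -/

/-- Every initial value problem with `φ(0) = a > 0` has a solution with total increase at most
`M`. -/
def SolutionBound (p f : ℝ → ℝ) (M : ℝ) : Prop :=
  ∀ a : ℝ, 0 < a → ∃ φ, IsCaratheodorySolution p f a φ ∧ φ 1 ≤ a + M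

/-- Each point of `[0,1)` has a right neighbourhood on which `p` is essentially bounded above. -/
def EssBoundedToRight (p : ℝ → ℝ) : Prop :=
  ∀ T ∈ Ico (0 : ℝ) 1, ∃ β ∈ Ioc T 1, ∃ C : ℝ, ∀ᵐ t ∂(volume.restrict (Ioo T β)), p t ≤ C

/-- A monotone limit of continuous functions that dominates the primitive of an integrable
function, and is a primitive of it to the right of every point, is a primitive of it. -/
lemma eq_integral_of_local {φ : ℕ → ℝ → ℝ} {Φ h : ℝ → ℝ} {a : ℝ}
    (hφc : ∀ k, ContinuousOn (φ k) (Icc 0 1))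
    (hφ : ∀ t ∈ Icc (0 : ℝ) 1, Tendsto (fun k => φ k t) atTop (𝓝 (Φ t)))
    (hle : ∀ k, ∀ t ∈ Icc (0 : ℝ) 1, φ k t ≤ Φ t)
    (hh : Integrable h unitMeasure) (hh0 : ∀ᵐ t ∂unitMeasure, 0 ≤ h t) (h0 : Φ 0 = a)
    (hsub : ∀ t ∈ Icc (0 : ℝ) 1, ∫ r in (0 : ℝ)..t, h r ≤ Φ t - a)
    (hloc : ∀ T ∈ Ico (0 : ℝ) 1, ∃ β ∈ Ioc T 1, ∀ t ∈ Ioo T β, Φ t - Φ T = ∫ r in T..t, h r) :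
    ∀ t ∈ Icc (0 : ℝ) 1, Φ t = a + ∫ r in (0 : ℝ)..t, h r := by
  let P : ℝ → Prop := fun t => Φ t = a + ∫ r in (0 : ℝ)..t, h r
  let S := {t : ℝ | ∀ r ∈ Icc 0 t, P r}
  have hz : (0 : ℝ) ∈ Icc (0 : ℝ) 1 := left_mem_Icc.2 zero_le_one
  have hP0 : P 0 := by simp [P, h0]
  suffices H : Icc (0 : ℝ) 1 ⊆ S from fun t ht => H ht t (right_mem_Icc.2 ht.1)
  refine IsClosed.Icc_subset_of_forall_exists_gt ?_ ?_ ?_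
  -- Passage to the limit from the left: some φ_k exceeds Φ(t) - ε at t, hence by continuity at some
  -- s < t, so Φ(t) - ε < Φ(s) = a + ∫₀ˢ h ≤ a + ∫₀ᵗ h.
  · have hleft : ∀ t ∈ Ioc (0 : ℝ) 1, (∀ r ∈ Ico 0 t, P r) → P t := by
      intro t ht hr
      have ht1 : t ∈ Icc (0 : ℝ) 1 := ⟨ht.1.le, ht.2⟩
      refine le_antisymm (le_of_forall_pos_lt_add fun ε hε => ?_) (by linarith [hsub t ht1])
      obtain ⟨k, hk⟩ := ((hφ t ht1).eventually (lt_mem_nhds (sub_lt_self _ hε))).exists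
      have h1 := ((hφc k t ht1).mono (Icc_subset_Icc_right ht.2)).eventually (lt_mem_nhds hk)
      have h2 : ∀ᶠ s in 𝓝[Ico 0 t] t, Φ t - ε < φ k s :=
        h1.filter_mono (nhdsWithin_mono _ Ico_subset_Icc_self)
      rw [nhdsWithin_Ico_eq_nhdsLT ht.1] at h2
      obtain ⟨s, hs, hst⟩ := (h2.and (Ico_mem_nhdsLT ht.1)).exists
      have hs1 : s ∈ Icc (0 : ℝ) 1 := ⟨hst.1, hst.2.le.trans ht.2⟩
      have h3 : Φ s = a + ∫ r in (0 : ℝ)..s, h r := hr s hst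
      have h4 := integral_nonneg_of_unit hs1 ht1 hst.2.le hh0
      rw [← integral_sub_of_unit hh hs1 ht1] at h4
      linarith [hle k s hs1]
    have e : S ∩ Icc 0 1 = Icc 0 1 ∩ ⋂ r ∈ Icc (0 : ℝ) 1, {t | t ≤ r} ∪ {t | P r} := by
      ext t
      simp only [mem_inter_iff, mem_iInter, mem_union, mem_ofPred_eq, S]
      constructor
      · rintro ⟨h1, h2⟩
        refine ⟨h2, fun r hr => ?_⟩
        rcases le_or_gt r t with h3 | h3
        · exact Or.inr (h1 r ⟨hr.1, h3⟩)
        · exact Or.inl h3.le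
      · rintro ⟨h1, h2⟩
        refine ⟨?_, h1⟩
        have hlt : ∀ r ∈ Ico 0 t, P r := fun r hr =>
          (h2 r ⟨hr.1, hr.2.le.trans h1.2⟩).resolve_left (not_le.2 hr.2)
        intro r hr
        rcases hr.2.eq_or_lt with rfl | h3
        · rcases h1.1.eq_or_lt with rfl | h4
          · exact hP0
          · exact hleft r ⟨h4, h1.2⟩ hlt
        · exact hlt r ⟨hr.1, h3⟩
    rw [e]
    refine isClosed_Icc.inter (isClosed_biInter fun r _ => isClosed_Iic.union ?_)
    by_cases hr : P r <;> simp [hr]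
  · intro r hr
    obtain rfl : r = 0 := le_antisymm hr.2 hr.1
    exact hP0
  · rintro T ⟨hTS, hT⟩ y hTy
    obtain ⟨β, hβ, hβ'⟩ := hloc T hT
    obtain ⟨z, hz1, hz2⟩ := exists_between (lt_min hTy hβ.1)
    have hzy := hz2.le.trans (min_le_left _ _)
    have hzβ := hz2.trans_le (min_le_right _ _)
    refine ⟨z, fun r hr => ?_, hz1, hzy⟩
    rcases le_or_gt r T with h1 | h1
    · exact hTS r ⟨hr.1, h1⟩
    · have h2 := hβ' r ⟨h1, hr.2.trans_lt hzβ⟩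
      have h3 : Φ T = a + ∫ r in (0 : ℝ)..T, h r := hTS T ⟨hT.1, le_rfl⟩
      rw [← integral_sub_of_unit hh ⟨hT.1, hT.2.le⟩ ⟨hr.1, (hr.2.trans hzβ.le).trans hβ.2⟩] at h2
      show Φ r = a + ∫ r in (0 : ℝ)..r, h r
      linarith

/-- The Fatou property of the solution bounds. -/
theorem SolutionBound.of_tendsto {p f : ℝ → ℝ} {M : ℝ} {F : ℕ → ℝ → ℝ} (hp : Measurable p)
    (hp1 : ∀ t, 1 ≤ p t) (hb : EssBoundedToRight p) (hf : Measurable f)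
    (hmono : ∀ k t, |F k t| ≤ |F (k + 1) t|)
    (hlim : ∀ᵐ t ∂unitMeasure, Tendsto (fun k => |F k t|) atTop (𝓝 |f t|))
    (h : ∀ k, SolutionBound p (F k) M) : SolutionBound p f M := by
  intro a ha
  choose φ hφ hφM using fun k => h k a ha
  have h01 : (0 : ℝ) ∈ Icc (0 : ℝ) 1 := left_mem_Icc.2 zero_le_one
  have h11 : (1 : ℝ) ∈ Icc (0 : ℝ) 1 := right_mem_Icc.2 zero_le_one
  have hφmono : ∀ t ∈ Icc (0 : ℝ) 1, Monotone fun k => φ k t := fun t ht =>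
    monotone_nat_of_le_succ fun k =>
      (hφ k).le_of_le (hφ (k + 1)) hp1 ha le_rfl (ae_of_all _ (hmono k)) ht
  have hφle : ∀ k, ∀ t ∈ Icc (0 : ℝ) 1, φ k t ≤ a + M := fun k t ht =>
    ((hφ k).apply_le hp1 ht).trans (hφM k)
  have haM : a ≤ a + M := ((hφ 0).le_apply hp1 h11).trans (hφM 0)
  have haM0 : 0 < a + M := ha.trans_le haM
  let Φ : ℝ → ℝ := fun t => ⨆ k, φ k t
  have hΦ : ∀ t ∈ Icc (0 : ℝ) 1, Tendsto (fun k => φ k t) atTop (𝓝 (Φ t)) := fun t ht =>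
    tendsto_atTop_ciSup (hφmono t ht) ⟨a + M, forall_mem_range.2 fun k => hφle k t ht⟩
  have hleΦ : ∀ k, ∀ t ∈ Icc (0 : ℝ) 1, φ k t ≤ Φ t := fun k t ht =>
    (hφmono t ht).ge_of_tendsto (hΦ t ht) k
  have hΦle : ∀ t ∈ Icc (0 : ℝ) 1, Φ t ≤ a + M := fun t ht =>
    le_of_tendsto' (hΦ t ht) fun k => hφle k t ht
  have haΦ : ∀ t ∈ Icc (0 : ℝ) 1, a ≤ Φ t := fun t ht =>
    ((hφ 0).le_apply hp1 ht).trans (hleΦ 0 t ht)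
  have hΦ0 : Φ 0 = a := tendsto_nhds_unique (hΦ 0 h01) <| by
    simp only [fun k => (hφ k).apply_zero, tendsto_const_nhds_iff]
  have hθ0 : ∀ k, ∀ᵐ t ∂unitMeasure, 0 ≤ odeField p (F k) (φ k t) t := fun k => by
    filter_upwards [ae_restrict_mem measurableSet_Icc] with t ht
    exact odeField_nonneg (hp1 t) ((hφ k).nonneg t ht)
  have hθ : ∀ᵐ t ∂unitMeasure,
      Tendsto (fun k => odeField p (F k) (φ k t) t) atTop (𝓝 (odeField p f (Φ t) t)) := by
    filter_upwards [hlim, ae_restrict_mem measurableSet_Icc] with t h1 ht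
    exact tendsto_odeField (hp1 t) h1 (hΦ t ht) (ha.trans_le (haΦ t ht))
  have hΘ : Integrable (fun t => odeField p f (Φ t) t) unitMeasure :=
    (integrable_and_integral_le_of_tendsto (fun k => (hφ k).integrable_unit) hθ0
      (fun k => (hφ k).integral_unit.le) ((hΦ 1 h11).sub_const a) hθ).1
  have hΘ0 : ∀ᵐ t ∂unitMeasure, 0 ≤ odeField p f (Φ t) t := by
    filter_upwards [ae_restrict_mem measurableSet_Icc] with t ht
    exact odeField_nonneg (hp1 t) (ha.le.trans (haΦ t ht))
  refine ⟨Φ, .mk_of_integrable (fun t ht => ha.le.trans (haΦ t ht)) hΘ ?_, hΦle 1 h11⟩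
  refine eq_integral_of_local (fun k => (hφ k).continuousOn) hΦ hleΦ hΘ hΘ0 hΦ0 ?_ ?_
  · intro t ht
    rw [intervalIntegral.integral_of_le ht.1]
    refine (integrable_and_integral_le_of_tendsto
      (fun k => ((hφ k).integrable_unit.intervalIntegrable_of_unit h01 ht).1)
      (fun k => ae_restrict_Ioc_of_unit (hθ0 k) le_rfl ht.2) (fun k => ?_)
      ((hΦ t ht).sub_const a) (ae_restrict_Ioc_of_unit hθ le_rfl ht.2)).2
    rw [← intervalIntegral.integral_of_le ht.1, ← (hφ k).sub_eq h01 ht, (hφ k).apply_zero]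
  · intro T hT
    obtain ⟨β, hβ, C, hC⟩ := hb T hT
    refine ⟨β, hβ, fun t ht => ?_⟩
    have hT1 : T ∈ Icc (0 : ℝ) 1 := ⟨hT.1, hT.2.le⟩
    have ht1 : t ∈ Icc (0 : ℝ) 1 := ⟨hT.1.trans ht.1.le, ht.2.le.trans hβ.2⟩
    -- The level a + M lies above Φ, so the field there is below the integrable Θ(Φ(t),t). Up to the
    -- factor ((a + M)/a)^C it dominates all approximating fields wherever p ≤ C.
    have hG : Integrable (odeField p f (a + M)) unitMeasure := by
      refine hΘ.mono' (hp.odeField hf measurable_const).aestronglyMeasurable ?_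
      filter_upwards [ae_restrict_mem measurableSet_Icc] with r hr
      rw [Real.norm_of_nonneg (odeField_nonneg (hp1 r) haM0.le)]
      exact odeField_anti (hp1 r) (ha.trans_le (haΦ r hr)) (hΦle r hr)
    have hlim' : Tendsto (fun k => ∫ r in T..t, odeField p (F k) (φ k r) r) atTop
        (𝓝 (∫ r in T..t, odeField p f (Φ r) r)) := by
      rw [intervalIntegral.integral_of_le ht.1.le]
      simp_rw [intervalIntegral.integral_of_le ht.1.le]
      refine tendsto_integral_of_dominated_convergence
        (fun r => ((a + M) / a) ^ C * odeField p f (a + M) r)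
        (fun k => ((hφ k).integrable_unit.intervalIntegrable_of_unit hT1 ht1).1.1)
        ((hG.intervalIntegrable_of_unit hT1 ht1).1.const_mul _) (fun k => ?_)
        (ae_restrict_Ioc_of_unit hθ hT.1 ht1.2)
      have hC' : ∀ᵐ r ∂(volume.restrict (Ioc T t)), p r ≤ C := ae_mono (Measure.restrict_mono
        (show Ioc T t ⊆ Ioo T β from fun r hr => ⟨hr.1, hr.2.trans_lt ht.2⟩) le_rfl) hC
      filter_upwards [hC', ae_restrict_Ioc_of_unit hlim hT.1 ht1.2,
        ae_restrict_mem measurableSet_Ioc] with r h1 h2 h3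
      have hr : r ∈ Icc (0 : ℝ) 1 := ⟨hT.1.trans h3.1.le, h3.2.trans ht1.2⟩
      have har := (hφ k).le_apply hp1 hr
      have hFf : |F k r| ≤ |f r| :=
        (monotone_nat_of_le_succ (f := fun k => |F k r|) fun k => hmono k r).ge_of_tendsto h2 k
      rw [Real.norm_of_nonneg (odeField_nonneg (hp1 r) (ha.le.trans har))]
      exact ((odeField_anti (hp1 r) ha har).trans (odeField_mono (hp1 r) ha.le hFf)).trans
        (odeField_le_mul (hp1 r) (fun _ => h1) ha haM)
    refine tendsto_nhds_unique (((hΦ t ht1).sub (hΦ T hT1)).congr fun k => ?_) hlim'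
    exact (hφ k).sub_eq hT1 ht1

/-! ### Stabilized solutions and the calculus of solution bounds -/

section Bounds

variable {p f g φ : ℝ → ℝ} {a M N n : ℝ}

/-- The coefficient vanishes a.e. where a solution has not left its initial value. -/
lemma IsCaratheodorySolution.ae_eq_zero_of_le (h : IsCaratheodorySolution p f a φ)
    (hp1 : ∀ t, 1 ≤ p t) (ha : 0 < a) : ∀ᵐ t ∂unitMeasure, φ t ≤ a → f t = 0 := by
  have hz : (0 : ℝ) ∈ Icc (0 : ℝ) 1 := left_mem_Icc.2 zero_le_one
  -- Up to the last time in S the solution is constant, so the nonnegative field has zero integral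
  -- and vanishes a.e. there.
  let S := {t ∈ Icc (0 : ℝ) 1 | φ t ≤ a}
  have hSc : IsCompact S := isCompact_Icc.of_isClosed_subset
    (isClosed_Icc.isClosed_le h.continuousOn continuousOn_const) fun r hr => hr.1
  have hs := hSc.sSup_mem ⟨0, hz, h.apply_zero.le⟩
  set s := sSup S
  have h0 : ∫ r in Ioc 0 s, odeField p f (φ r) r = 0 := by
    rw [← intervalIntegral.integral_of_le hs.1.1, ← h.sub_eq hz hs.1, h.apply_zero]
    linarith [hs.2, h.le_apply hp1 hs.1]
  have hnn : ∀ᵐ r ∂unitMeasure, 0 ≤ odeField p f (φ r) r := by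
    filter_upwards [ae_restrict_mem measurableSet_Icc] with r hr
    exact odeField_nonneg (hp1 r) (h.nonneg r hr)
  rw [setIntegral_eq_zero_iff_of_nonneg_ae (ae_restrict_Ioc_of_unit hnn le_rfl hs.1.2)
    (h.integrable_unit.intervalIntegrable_of_unit hz hs.1).1] at h0
  have h1 := ae_restrict_of_ae (s := Icc (0 : ℝ) 1) ((ae_restrict_iff' measurableSet_Ioc).1 h0)
  have h2 : ∀ᵐ r ∂unitMeasure, r ≠ 0 :=
    ae_restrict_of_ae (compl_mem_ae_iff.2 (measure_singleton 0))
  filter_upwards [h1, h2, ae_restrict_mem measurableSet_Icc] with r h1 h2 hr hra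
  exact eq_zero_of_odeField_eq_zero (hp1 r) (ha.trans_le (h.le_apply hp1 hr))
    (h1 ⟨hr.1.lt_of_ne' h2, le_csSup hSc.bddAbove ⟨hr, hra⟩⟩)

/-- If all the positive initial value problems are solvable, the stabilized solution exists. -/
theorem exists_isStabilizedSolution (hp1 : ∀ t, 1 ≤ p t)
    (h : ∀ a : ℝ, 0 < a → ∃ φ, IsCaratheodorySolution p f a φ) :
    ∃ φ, IsStabilizedSolution p f φ := by
  choose! ψ hψ using h
  have h01 : (0 : ℝ) ∈ Icc (0 : ℝ) 1 := left_mem_Icc.2 zero_le_one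
  let b : ℕ → ℝ := fun k => 1 / ((k : ℝ) + 1)
  have hb0 : ∀ k, 0 < b k := fun k => Nat.one_div_pos_of_nat
  have hb : Tendsto b atTop (𝓝 0) := tendsto_one_div_add_atTop_nhds_zero_nat
  have hmono : ∀ {a c : ℝ}, 0 < a → a ≤ c → ∀ t ∈ Icc (0 : ℝ) 1, ψ a t ≤ ψ c t :=
    fun ha hac t ht => (hψ _ ha).le_of_le (hψ _ (ha.trans_le hac)) hp1 (ha.trans_le hac) hac
      (ae_of_all _ fun _ => le_rfl) ht
  let φ : ℝ → ℝ := fun t => ⨅ k, ψ (b k) t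
  have hφ : ∀ t ∈ Icc (0 : ℝ) 1, Tendsto (fun k => ψ (b k) t) atTop (𝓝 (φ t)) := fun t ht =>
    tendsto_atTop_ciInf
      (fun k l hkl => hmono (hb0 l) (Nat.one_div_le_one_div hkl) t ht)
      ⟨0, forall_mem_range.2 fun k => (hψ _ (hb0 k)).nonneg t ht⟩
  have hφ0 : ∀ t ∈ Icc (0 : ℝ) 1, 0 ≤ φ t := fun t ht =>
    ge_of_tendsto' (hφ t ht) fun k => (hψ _ (hb0 k)).nonneg t ht
  have hle : ∀ a, 0 < a → ∀ t ∈ Icc (0 : ℝ) 1, φ t ≤ ψ a t := fun a ha t ht =>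
    le_of_tendsto (hφ t ht) <| by
      filter_upwards [hb.eventually (gt_mem_nhds ha)] with k hk
      exact hmono (hb0 k) hk.le t ht
  -- Letting b → 0 in ψ_a ≤ ψ_b + (a - b). Together with `hle` this squeezes ψ_a between φ and φ +
  -- a.
  have hge : ∀ a, 0 < a → ∀ t ∈ Icc (0 : ℝ) 1, ψ a t ≤ φ t + a := fun a ha t ht => by
    have h1 : Tendsto (fun k => ψ (b k) t + (a - b k)) atTop (𝓝 (φ t + (a - 0))) :=
      (hφ t ht).add (tendsto_const_nhds.sub hb)
    rw [sub_zero] at h1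
    refine ge_of_tendsto h1 ?_
    filter_upwards [hb.eventually (gt_mem_nhds ha)] with k hk
    exact (hψ _ (hb0 k)).le_add (hψ a ha) hp1 (hb0 k) hk.le ht
  refine ⟨φ, ⟨ψ, hψ, fun t ht => ?_⟩, ?_⟩
  · have h1 : Tendsto (fun a : ℝ => φ t + a) (𝓝[>] 0) (𝓝 (φ t)) := by
      have : Tendsto (fun a : ℝ => φ t + a) (𝓝 0) (𝓝 (φ t + 0)) := tendsto_const_nhds.add tendsto_id
      rw [add_zero] at this
      exact this.mono_left nhdsWithin_le_nhds
    refine tendsto_of_tendsto_of_tendsto_of_le_of_le' tendsto_const_nhds h1 ?_ ?_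
    · filter_upwards [self_mem_nhdsWithin] with a ha using hle a ha t ht
    · filter_upwards [self_mem_nhdsWithin] with a ha using hge a ha t ht
  -- Where φ = 0, the solution starting at 1 is still at most 1, so f vanishes a.e. there. This
  -- removes the singularity of Θ at x = 0 in the limits below.
  have hzero : ∀ᵐ t ∂unitMeasure, φ t = 0 → f t = 0 := by
    filter_upwards [(hψ 1 one_pos).ae_eq_zero_of_le hp1 one_pos, ae_restrict_mem measurableSet_Icc]
      with t h1 ht h2
    refine h1 ((hge 1 one_pos t ht).trans ?_)
    rw [h2, zero_add]
  have hnn : ∀ k, ∀ᵐ t ∂unitMeasure, 0 ≤ odeField p f (ψ (b k) t) t := fun k => by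
    filter_upwards [ae_restrict_mem measurableSet_Icc] with t ht
    exact odeField_nonneg (hp1 t) ((hψ _ (hb0 k)).nonneg t ht)
  have hlim : ∀ᵐ t ∂unitMeasure, Tendsto (fun k => odeField p f (ψ (b k) t) t) atTop
      (𝓝 (odeField p f (φ t) t)) := by
    filter_upwards [hzero, ae_restrict_mem measurableSet_Icc] with t h1 ht
    rcases (hφ0 t ht).eq_or_lt with h2 | h2
    · simp only [odeField_of_eq_zero (hp1 t) (h1 h2.symm), tendsto_const_nhds_iff]
    · exact tendsto_odeField (hp1 t) tendsto_const_nhds (hφ t ht) h2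
  have hbound : ∀ k, ∀ᵐ t ∂unitMeasure, odeField p f (ψ (b k) t) t ≤ odeField p f (φ t) t :=
      fun k => by
    filter_upwards [hzero, ae_restrict_mem measurableSet_Icc] with t h1 ht
    rcases (hφ0 t ht).eq_or_lt with h2 | h2
    · simp only [odeField_of_eq_zero (hp1 t) (h1 h2.symm), le_refl]
    · exact odeField_anti (hp1 t) h2 (hle _ (hb0 k) t ht)
  have hi := (integrable_and_integral_le_of_tendsto (fun k => (hψ _ (hb0 k)).integrable_unit) hnn
    (fun k => (hψ _ (hb0 k)).integral_unit.le)
    ((hφ 1 (right_mem_Icc.2 zero_le_one)).sub hb) hlim).1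
  refine .mk_of_integrable hφ0 hi fun T hT => ?_
  refine tendsto_nhds_unique (hφ T hT) ?_
  have hint : Tendsto (fun k => ∫ t in (0 : ℝ)..T, odeField p f (ψ (b k) t) t) atTop
      (𝓝 (∫ t in (0 : ℝ)..T, odeField p f (φ t) t)) := by
    rw [intervalIntegral.integral_of_le hT.1]
    simp_rw [intervalIntegral.integral_of_le hT.1]
    refine tendsto_integral_of_dominated_convergence _
      (fun k => ((hψ _ (hb0 k)).integrable_unit.intervalIntegrable_of_unit h01 hT).1.1)
      (hi.intervalIntegrable_of_unit h01 hT).1 (fun k => ?_)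
      (ae_restrict_Ioc_of_unit hlim le_rfl hT.2)
    filter_upwards [ae_restrict_Ioc_of_unit (hnn k) le_rfl hT.2,
      ae_restrict_Ioc_of_unit (hbound k) le_rfl hT.2] with t h1 h2
    rwa [Real.norm_of_nonneg h1]
  exact (hb.add hint).congr fun k => ((hψ _ (hb0 k)).eq_integral T hT).symm

lemma IsStabilizedSolution.solutionBound (hp1 : ∀ t, 1 ≤ p t) (h : IsStabilizedSolution p f φ) :
    SolutionBound p f (φ 1) := by
  obtain ⟨⟨ψ, hψ, hlim⟩, -⟩ := h
  have h11 : (1 : ℝ) ∈ Icc (0 : ℝ) 1 := right_mem_Icc.2 zero_le_one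
  refine fun a ha => ⟨ψ a, hψ a ha, ?_⟩
  rw [add_comm]
  have h1 : Tendsto (fun b : ℝ => ψ b 1 + (a - b)) (𝓝[>] 0) (𝓝 (φ 1 + (a - 0))) :=
    (hlim 1 h11).add (tendsto_const_nhds.sub (tendsto_id.mono_left nhdsWithin_le_nhds))
  rw [sub_zero] at h1
  refine ge_of_tendsto h1 ?_
  filter_upwards [Ioc_mem_nhdsGT ha] with b hb
  exact (hψ b hb.1).le_add (hψ a ha) hp1 hb.1 hb.2 h11

lemma IsStabilizedSolution.le_of_solutionBound (hp1 : ∀ t, 1 ≤ p t)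
    (h : IsStabilizedSolution p f φ) (hM : SolutionBound p f M) : φ 1 ≤ M := by
  obtain ⟨⟨ψ, hψ, hlim⟩, -⟩ := h
  have h11 : (1 : ℝ) ∈ Icc (0 : ℝ) 1 := right_mem_Icc.2 zero_le_one
  have h1 : Tendsto (fun a : ℝ => a + M) (𝓝[>] 0) (𝓝 (0 + M)) :=
    (tendsto_id.mono_left nhdsWithin_le_nhds).add tendsto_const_nhds
  rw [zero_add] at h1
  refine le_of_tendsto_of_tendsto (hlim 1 h11) h1 ?_
  filter_upwards [self_mem_nhdsWithin] with a ha
  obtain ⟨χ, hχ, hχM⟩ := hM a ha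
  exact ((hψ a ha).le_of_le hχ hp1 ha le_rfl (ae_of_all _ fun _ => le_rfl) h11).trans hχM

lemma SolutionBound.weaken (h : SolutionBound p f M) (hMN : M ≤ N) : SolutionBound p f N :=
  fun a ha => (h a ha).imp fun _ hφ => ⟨hφ.1, by linarith [hφ.2]⟩

/-- Any two stabilized solutions bound each other at 1, so the infimum is over at most one value.
The bridge from the norm to solution bounds; `hM` excludes negative M, which `ENNReal.ofReal` sends
to 0. -/
lemma odeENorm_le_ofReal_iff (hp1 : ∀ t, 1 ≤ p t) (hM : 0 ≤ M) :
    odeENorm p f ≤ ENNReal.ofReal M ↔ SolutionBound p f M := by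
  constructor
  · intro h
    by_cases hex : ∃ φ, IsStabilizedSolution p f φ
    · obtain ⟨φ, hφ⟩ := hex
      have h1 : ENNReal.ofReal (φ 1) ≤ odeENorm p f := le_iInf₂ fun φ' hφ' =>
        ENNReal.ofReal_le_ofReal (hφ.le_of_solutionBound hp1 (hφ'.solutionBound hp1))
      have h2 := (ENNReal.ofReal_le_ofReal_iff hM).1 (h1.trans h)
      exact (hφ.solutionBound hp1).weaken h2
    · have : odeENorm p f = ⊤ := iInf₂_eq_top.2 fun φ hφ => absurd ⟨φ, hφ⟩ hex
      rw [this, top_le_iff] at h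
      exact absurd h ENNReal.ofReal_ne_top
  · intro h
    obtain ⟨φ, hφ⟩ := exists_isStabilizedSolution (f := f) hp1 fun a ha =>
      (h a ha).imp fun _ hχ => hχ.1
    exact (iInf₂_le φ hφ).trans (ENNReal.ofReal_le_ofReal (hφ.le_of_solutionBound hp1 h))

lemma exists_isStabilizedSolution_iff :
    (∃ φ, IsStabilizedSolution p f φ) ↔ odeENorm p f < ∞ := by
  constructor
  · rintro ⟨φ, hφ⟩
    exact (iInf₂_le φ hφ).trans_lt ENNReal.ofReal_lt_top
  · intro h
    by_contra hex
    exact h.ne (iInf₂_eq_top.2 fun φ hφ => absurd ⟨φ, hφ⟩ hex)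

lemma le_of_indicator_ne_zero {t : ℝ} (ht : {t | p t ≤ n}.indicator f t ≠ 0) : p t ≤ n := by
  have := mem_of_indicator_ne_zero ht
  rwa [mem_ofPred_eq] at this

namespace SolutionBound

lemma nonneg (h : SolutionBound p f M) (hp1 : ∀ t, 1 ≤ p t) : 0 ≤ M := by
  obtain ⟨φ, hφ, hM⟩ := h 1 one_pos
  linarith [hφ.le_apply hp1 (right_mem_Icc.2 zero_le_one)]

lemma congr (h : SolutionBound p f M) (hfg : f =ᵐ[unitMeasure] g) : SolutionBound p g M :=
  fun a ha => (h a ha).imp fun _ hφ => ⟨hφ.1.congr EventuallyEq.rfl hfg, hφ.2⟩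

lemma zero (hp1 : ∀ t, 1 ≤ p t) : SolutionBound p 0 0 := by
  have e : ∀ x : ℝ → ℝ, (fun t => odeField p 0 (x t) t) = 0 := fun x =>
    funext fun t => odeField_of_eq_zero (hp1 t) rfl
  refine fun a ha => ⟨fun _ => a, .mk_of_integrable (fun _ _ => ha.le) ?_ ?_, (add_zero a).ge⟩
  · rw [e]
    exact integrable_zero _ _ _
  · intro T _
    rw [e]
    simp [intervalIntegral]

lemma smul (h : SolutionBound p f M) (hp1 : ∀ t, 1 ≤ p t) (c : ℝ) :
    SolutionBound p (c • f) (|c| * M) := by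
  rcases eq_or_ne c 0 with rfl | hc
  · simpa using zero hp1
  have hc' : 0 < |c| := abs_pos.2 hc
  intro a ha
  obtain ⟨φ, hφ, hM⟩ := h (a / |c|) (by positivity)
  have e : ∀ t ∈ Icc (0 : ℝ) 1,
      odeField p (c • f) (|c| * φ t) t = |c| * odeField p f (φ t) t := fun t ht =>
    odeField_smul hc ((div_pos ha hc').trans_le (hφ.le_apply hp1 ht))
  refine ⟨fun t => |c| * φ t, .mk_of_integrable (fun t ht => ?_) ?_ fun T hT => ?_, ?_⟩
  · exact mul_nonneg hc'.le (hφ.nonneg t ht)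
  · refine (hφ.integrable_unit.const_mul |c|).congr ?_
    filter_upwards [ae_restrict_mem measurableSet_Icc] with t ht using (e t ht).symm
  · have e2 : ∫ t in (0 : ℝ)..T, odeField p (c • f) (|c| * φ t) t =
        ∫ t in (0 : ℝ)..T, |c| * odeField p f (φ t) t :=
      intervalIntegral.integral_congr fun t ht => by
        rw [uIcc_of_le hT.1] at ht
        exact e t ⟨ht.1, ht.2.trans hT.2⟩
    rw [e2, intervalIntegral.integral_const_mul, hφ.eq_integral T hT]
    field_simp
  · calc |c| * φ 1 ≤ |c| * (a / |c| + M) := by gcongr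
      _ = a + |c| * M := by field_simp

lemma ae_eq_zero (h : SolutionBound p f 0) (hp1 : ∀ t, 1 ≤ p t) : f =ᵐ[unitMeasure] 0 := by
  obtain ⟨φ, hφ, hM⟩ := h 1 one_pos
  filter_upwards [hφ.ae_eq_zero_of_le hp1 one_pos, ae_restrict_mem measurableSet_Icc] with t h1 ht
  exact h1 ((hφ.apply_le hp1 ht).trans (hM.trans (add_zero 1).le))

/-- Along the solution starting at 1, the field has integral at most M and the solution is at most 1
+ M; the sum is 2M + 1. -/
lemma lintegral_enorm_le (h : SolutionBound p f M) (hp1 : ∀ t, 1 ≤ p t) (hf : Measurable f) :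
    ∫⁻ t, ‖f t‖ₑ ∂unitMeasure ≤ ENNReal.ofReal (2 * M + 1) := by
  obtain ⟨φ, hφ, hM⟩ := h 1 one_pos
  have hi : Integrable (fun t => odeField p f (φ t) t + (1 + M)) unitMeasure :=
    hφ.integrable_unit.add (integrable_const _)
  have hle : ∀ᵐ t ∂unitMeasure, ‖f t‖ ≤ odeField p f (φ t) t + (1 + M) := by
    filter_upwards [ae_restrict_mem measurableSet_Icc] with t ht
    have h1 := abs_le_odeField_add (f := f) (hp1 t) (one_pos.trans_le (hφ.le_apply hp1 ht))
    rw [Real.norm_eq_abs]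
    linarith [hφ.apply_le hp1 ht]
  have hfi : Integrable f unitMeasure := hi.mono' hf.aestronglyMeasurable hle
  rw [← ofReal_integral_norm_eq_lintegral_enorm hfi]
  refine ENNReal.ofReal_le_ofReal ((integral_mono_ae hfi.norm hi hle).trans ?_)
  rw [integral_add hφ.integrable_unit (integrable_const _), hφ.integral_unit]
  simp
  linarith

/-- The field of g at level a is at most a constant times its value at a + M, which is below the
field of f along the given solution. This supplies the integrability needed for existence. -/
lemma integrable_odeField (h : SolutionBound p f M) (hp : Measurable p) (hp1 : ∀ t, 1 ≤ p t)
    (hg : Measurable g) (hfg : ∀ᵐ t ∂unitMeasure, |g t| ≤ |f t|) (hn : ∀ t, g t ≠ 0 → p t ≤ n)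
    (ha : 0 < a) :
    Integrable (odeField p g a) unitMeasure := by
  obtain ⟨φ, hφ, hM⟩ := h a ha
  have hM0 := h.nonneg hp1
  refine (hφ.integrable_unit.const_mul (((a + M) / a) ^ n)).mono'
    (hp.odeField hg measurable_const).aestronglyMeasurable ?_
  filter_upwards [hfg, ae_restrict_mem measurableSet_Icc] with t hgt ht
  have hat := hφ.le_apply hp1 ht
  rw [Real.norm_of_nonneg (odeField_nonneg (hp1 t) ha.le)]
  refine (odeField_le_mul (hp1 t) (hn t) ha (le_add_of_nonneg_right hM0)).trans ?_
  refine mul_le_mul_of_nonneg_left ?_ (by positivity)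
  exact (odeField_anti (hp1 t) (ha.trans_le hat) ((hφ.apply_le hp1 ht).trans hM)).trans
    (odeField_mono (hp1 t) (hφ.nonneg t ht) hgt)

lemma mono_of_bounded (h : SolutionBound p f M) (hp : Measurable p) (hp1 : ∀ t, 1 ≤ p t)
    (hg : Measurable g) (hfg : ∀ᵐ t ∂unitMeasure, |g t| ≤ |f t|) (hn : ∀ t, g t ≠ 0 → p t ≤ n) :
    SolutionBound p g M := by
  intro a ha
  obtain ⟨φ, hφ, hM⟩ := h a ha
  obtain ⟨χ, hχ⟩ := exists_isCaratheodorySolution hp hp1 hg ha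
    (h.integrable_odeField hp hp1 hg hfg hn ha) hn
  exact ⟨χ, hχ, (hχ.le_of_le hφ hp1 ha le_rfl hfg
    (right_mem_Icc.2 zero_le_one)).trans hM⟩

lemma add_of_bounded (h : SolutionBound p f M) (h' : SolutionBound p g N) (hp : Measurable p)
    (hp1 : ∀ t, 1 ≤ p t) (hf : Measurable f) (hg : Measurable g) (hnf : ∀ t, f t ≠ 0 → p t ≤ n)
    (hng : ∀ t, g t ≠ 0 → p t ≤ n) : SolutionBound p (f + g) (M + N) := by
  intro a ha
  -- The initial value is split evenly, so that the sum of the two solutions starts at a and is a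
  -- supersolution for f + g.
  have ha2 : 0 < a / 2 := half_pos ha
  have hi : Integrable (odeField p (f + g) a) unitMeasure := by
    refine ((h.integrable_odeField hp hp1 hf (ae_of_all _ fun _ => le_rfl) hnf ha2).add
      (h'.integrable_odeField hp hp1 hg (ae_of_all _ fun _ => le_rfl) hng ha2)).mono'
      (hp.odeField (hf.add hg) measurable_const).aestronglyMeasurable (ae_of_all _ fun t => ?_)
    rw [Real.norm_of_nonneg (odeField_nonneg (hp1 t) ha.le)]
    simpa using odeField_add_le (f := f) (g := g) (hp1 t) ha2 ha2
  obtain ⟨χ, hχ⟩ := exists_isCaratheodorySolution hp hp1 (hf.add hg) ha hi (n := n) fun t ht => by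
    by_cases h0 : f t = 0
    · refine hng t fun h1 => ht ?_
      simp [h0, h1]
    · exact hnf t h0
  obtain ⟨φ, hφ, hM⟩ := h (a / 2) ha2
  obtain ⟨ψ, hψ, hN⟩ := h' (a / 2) ha2
  have hφ0 : ∀ t ∈ Icc (0 : ℝ) 1, 0 < φ t := fun t ht => ha2.trans_le (hφ.le_apply hp1 ht)
  have hψ0 : ∀ t ∈ Icc (0 : ℝ) 1, 0 < ψ t := fun t ht => ha2.trans_le (hψ.le_apply hp1 ht)
  refine ⟨χ, hχ, ?_⟩
  have key := hχ.le_supersolution (ψ := fun t => φ t + ψ t) hp1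
    (hφ.continuousOn.add hψ.continuousOn) (fun t ht => add_pos (hφ0 t ht) (hψ0 t ht))
    (by simp [hφ.apply_zero, hψ.apply_zero]) (hφ.integrable_unit.add hψ.integrable_unit)
    (fun s hs t ht _ => ?_) ?_ (right_mem_Icc.2 zero_le_one)
  · linarith
  · refine (intervalIntegral.integral_add (hφ.integrable_unit.intervalIntegrable_of_unit hs ht)
      (hψ.integrable_unit.intervalIntegrable_of_unit hs ht)).le.trans ?_
    rw [← hφ.sub_eq hs ht, ← hψ.sub_eq hs ht]
    linarith
  · filter_upwards [ae_restrict_mem measurableSet_Icc] with t ht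
    exact odeField_add_le (hp1 t) (hφ0 t ht) (hψ0 t ht)

/-- A bound for all the truncations to `{p ≤ k}` is a bound for the function. -/
lemma of_indicator (hp : Measurable p) (hp1 : ∀ t, 1 ≤ p t) (hb : EssBoundedToRight p)
    (hf : Measurable f) (h : ∀ k : ℕ, SolutionBound p ({t | p t ≤ (k : ℝ)}.indicator f) M) :
    SolutionBound p f M := by
  refine of_tendsto (F := fun k => {t | p t ≤ (k : ℝ)}.indicator f) hp hp1 hb hf
    (fun k t => ?_) (ae_of_all _ fun t => ?_) h
  · simp only [← Real.norm_eq_abs]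
    refine norm_indicator_le_of_subset (fun s hs => ?_) f t
    rw [mem_ofPred_eq] at hs ⊢
    exact hs.trans (by push_cast; linarith)
  · obtain ⟨m, hm⟩ := exists_nat_ge (p t)
    refine tendsto_const_nhds.congr' ?_
    filter_upwards [eventually_ge_atTop m] with k hk
    rw [indicator_of_mem]
    rw [mem_ofPred_eq]
    exact hm.trans (Nat.cast_le.2 hk)

lemma indicator (h : SolutionBound p f M) (hp : Measurable p) (hp1 : ∀ t, 1 ≤ p t)
    (hf : Measurable f) (n : ℝ) : SolutionBound p ({t | p t ≤ n}.indicator f) M := by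
  refine h.mono_of_bounded hp hp1 (hf.indicator (measurableSet_le hp measurable_const))
    (ae_of_all _ fun t => ?_) (n := n) fun t ht => le_of_indicator_ne_zero ht
  simpa only [← Real.norm_eq_abs] using norm_indicator_le_norm_self f t

lemma mono (h : SolutionBound p f M) (hp : Measurable p) (hp1 : ∀ t, 1 ≤ p t)
    (hb : EssBoundedToRight p) (hg : Measurable g) (hfg : ∀ᵐ t ∂unitMeasure, |g t| ≤ |f t|) :
    SolutionBound p g M := by
  refine of_indicator hp hp1 hb hg fun k => h.mono_of_bounded hp hp1
    (hg.indicator (measurableSet_le hp measurable_const)) ?_ (n := k)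
    fun t ht => le_of_indicator_ne_zero ht
  filter_upwards [hfg] with t ht
  refine le_trans ?_ ht
  simpa only [← Real.norm_eq_abs] using norm_indicator_le_norm_self g t

lemma add (h : SolutionBound p f M) (h' : SolutionBound p g N) (hp : Measurable p)
    (hp1 : ∀ t, 1 ≤ p t) (hb : EssBoundedToRight p) (hf : Measurable f) (hg : Measurable g) :
    SolutionBound p (f + g) (M + N) := by
  refine of_indicator hp hp1 hb (hf.add hg) fun k => ?_
  rw [indicator_add']
  have hm : MeasurableSet {t | p t ≤ (k : ℝ)} := measurableSet_le hp measurable_const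
  exact (h.indicator hp hp1 hf k).add_of_bounded (h'.indicator hp hp1 hg k) hp hp1
    (hf.indicator hm) (hg.indicator hm) (fun t ht => le_of_indicator_ne_zero ht)
    fun t ht => le_of_indicator_ne_zero ht

end SolutionBound

end Bounds

/-! ### Absolutely convergent series -/

section Series

variable {p : ℝ → ℝ} {U : ℕ → ℝ → ℝ} {c : ℕ → ℝ}

lemma SolutionBound.sum_abs (hp : Measurable p) (hp1 : ∀ t, 1 ≤ p t) (hb : EssBoundedToRight p)
    (hU : ∀ k, Measurable (U k)) (h : ∀ k, SolutionBound p (U k) (c k)) (m : ℕ) :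
    SolutionBound p (fun t => ∑ k ∈ Finset.range m, |U k t|) (∑ k ∈ Finset.range m, c k) := by
  induction m with
  | zero => simpa using! SolutionBound.zero hp1
  | succ m ih =>
    simp_rw [Finset.sum_range_succ]
    exact ih.add ((h m).mono hp hp1 hb (hU m).abs (ae_of_all _ fun t => (abs_abs _).le)) hp hp1 hb
      (Finset.measurable_fun_sum _ fun k _ => (hU k).abs) (hU m).abs

lemma ae_summable_abs (hp : Measurable p) (hp1 : ∀ t, 1 ≤ p t) (hb : EssBoundedToRight p)
    (hU : ∀ k, Measurable (U k)) (hc : Summable c) (h : ∀ k, SolutionBound p (U k) (c k)) :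
    ∀ᵐ t ∂unitMeasure, Summable fun k => |U k t| := by
  have hfin : ∫⁻ t, ∑' k, ‖U k t‖ₑ ∂unitMeasure ≤ ENNReal.ofReal (2 * (∑' k, c k) + 1) := by
    rw [lintegral_tsum fun k => (hU k).enorm.aemeasurable]
    refine ENNReal.tsum_le_of_sum_range_le fun m => ?_
    rw [← lintegral_finsetSum _ fun k _ => (hU k).enorm]
    have h1 := (SolutionBound.sum_abs hp hp1 hb hU h m).lintegral_enorm_le hp1
      (Finset.measurable_fun_sum _ fun k _ => (hU k).abs)
    have h2 := hc.sum_le_tsum (Finset.range m) fun k _ => (h k).nonneg hp1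
    refine le_trans (le_of_eq (lintegral_congr fun t => ?_))
      (h1.trans (ENNReal.ofReal_le_ofReal (by linarith)))
    rw [Real.enorm_of_nonneg (Finset.sum_nonneg fun k _ => abs_nonneg _),
      ENNReal.ofReal_sum_of_nonneg fun k _ => abs_nonneg _]
    exact Finset.sum_congr rfl fun k _ => by
      rw [← Real.enorm_abs, Real.enorm_of_nonneg (abs_nonneg _)]
  filter_upwards [ae_lt_top (Measurable.tsum fun k => (hU k).enorm)
    (ne_top_of_le_ne_top ENNReal.ofReal_ne_top hfin)] with t ht
  have h1 := ENNReal.summable_toReal ht.ne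
  simpa using h1

/-- Absolutely convergent series converge, with the expected bounds for the remainders. -/
theorem exists_sum_solutionBound (hp : Measurable p) (hp1 : ∀ t, 1 ≤ p t)
    (hb : EssBoundedToRight p) (hU : ∀ k, Measurable (U k)) (hc : Summable c)
    (h : ∀ k, SolutionBound p (U k) (c k)) :
    ∃ f : ℝ → ℝ, Measurable f ∧ ∀ K, SolutionBound p
      (fun t => (∑ k ∈ Finset.range K, U k t) - f t) (∑' k, c (k + K)) := by
  have hsum := ae_summable_abs hp hp1 hb hU hc h
  have hUm : ∀ m, Measurable fun t => ∑ k ∈ Finset.range m, U k t := fun m =>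
    Finset.measurable_fun_sum _ fun k _ => hU k
  obtain ⟨f, hf, hflim⟩ := measurable_limit_of_tendsto_metrizable_ae (L := atTop)
    (fun m => (hUm m).aemeasurable) (by
      filter_upwards [hsum] with t ht using ⟨_, ht.of_abs.hasSum.tendsto_sum_nat⟩)
  refine ⟨f, hf, fun K => ?_⟩
  let H : ℕ → ℝ → ℝ := fun m t => ∑ k ∈ Finset.range m, |U (k + K) t|
  have hHm : ∀ m, Measurable (H m) := fun m =>
    Finset.measurable_fun_sum _ fun k _ => (hU (k + K)).abs
  have hH0 : ∀ m t, 0 ≤ H m t := fun m t => Finset.sum_nonneg fun k _ => abs_nonneg _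
  have hsumK : ∀ᵐ t ∂unitMeasure, Summable fun k => |U (k + K) t| := by
    filter_upwards [hsum] with t ht using (summable_nat_add_iff K).2 ht
  obtain ⟨g, hg, hglim⟩ := measurable_limit_of_tendsto_metrizable_ae (f := H) (L := atTop)
    (fun m => (hHm m).aemeasurable) (by
      filter_upwards [hsumK] with t ht using ⟨_, ht.hasSum.tendsto_sum_nat⟩)
  -- The tail of absolute values is an increasing limit, so the Fatou property bounds it; the
  -- remainder is dominated by it a.e.
  have hgS : SolutionBound p g (∑' k, c (k + K)) := by
    refine SolutionBound.of_tendsto hp hp1 hb hg (F := H) (fun m t => ?_) ?_ fun m => ?_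
    · rw [abs_of_nonneg (hH0 m t), abs_of_nonneg (hH0 (m + 1) t)]
      exact Finset.sum_le_sum_of_subset_of_nonneg (Finset.range_subset_range.2 m.le_succ)
        fun k _ _ => abs_nonneg _
    · filter_upwards [hglim] with t ht using ht.abs
    · exact (SolutionBound.sum_abs hp hp1 hb (fun k => hU (k + K)) (fun k => h (k + K)) m).weaken
        (((summable_nat_add_iff K).2 hc).sum_le_tsum _ fun k _ => (h (k + K)).nonneg hp1)
  refine hgS.mono hp hp1 hb ((hUm K).sub hf) ?_
  filter_upwards [hflim, hglim] with t h1 h2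
  have h3 : Tendsto (fun m => |∑ k ∈ Finset.range K, U k t - ∑ k ∈ Finset.range (m + K), U k t|)
      atTop (𝓝 |∑ k ∈ Finset.range K, U k t - f t|) :=
    (tendsto_const_nhds.sub (h1.comp (tendsto_add_atTop_nat K))).abs
  refine (le_of_tendsto_of_tendsto' h3 h2 fun m => ?_).trans (le_abs_self _)
  rw [add_comm m K, Finset.sum_range_add, sub_add_cancel_left, abs_neg]
  refine (Finset.abs_sum_le_sum_abs _ _).trans (le_of_eq ?_)
  exact Finset.sum_congr rfl fun k _ => by rw [add_comm K k]

end Series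

/-! ### The norm identity and the Banach space -/

section Norm

variable {p f : ℝ → ℝ} {M : ℝ}

lemma solutionBound_toReal (hp1 : ∀ t, 1 ≤ p t) (h : odeENorm p f < ∞) :
    SolutionBound p f (odeENorm p f).toReal :=
  (odeENorm_le_ofReal_iff hp1 ENNReal.toReal_nonneg).1 (ENNReal.ofReal_toReal h.ne).ge

lemma SolutionBound.toReal_odeENorm_le (h : SolutionBound p f M) (hp1 : ∀ t, 1 ≤ p t) :
    (odeENorm p f).toReal ≤ M :=
  ENNReal.toReal_le_of_le_ofReal (h.nonneg hp1)
    ((odeENorm_le_ofReal_iff hp1 (h.nonneg hp1)).2 h)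

lemma SolutionBound.odeENorm_lt_top (h : SolutionBound p f M) (hp1 : ∀ t, 1 ≤ p t) :
    odeENorm p f < ∞ :=
  ((odeENorm_le_ofReal_iff hp1 (h.nonneg hp1)).2 h).trans_lt ENNReal.ofReal_lt_top

theorem odeENorm_eq_extENorm (hp : Measurable p) (hp1 : ∀ t, 1 ≤ p t)
    (hb : EssBoundedToRight p) (hf : Measurable f) : odeENorm p f = extENorm p f := by
  -- The two quantities are compared through their finite upper bounds, each of which is a solution
  -- bound for f or for all truncations.
  refine eq_of_forall_ge_iff fun x => ?_
  rcases eq_or_ne x ⊤ with rfl | hx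
  · simp
  rw [← ENNReal.ofReal_toReal hx, odeENorm_le_ofReal_iff hp1 ENNReal.toReal_nonneg, extENorm,
    iSup_le_iff]
  simp_rw [odeENorm_le_ofReal_iff hp1 (ENNReal.toReal_nonneg (a := x))]
  exact ⟨fun h n => h.indicator hp hp1 hf n, fun h => .of_indicator hp hp1 hb hf h⟩

lemma mem_varLp_iff {f : LZero} : f ∈ VarLp p ↔ odeENorm p f < ∞ :=
  exists_isStabilizedSolution_iff

/-- The space `L^{p(·)}` as a linear subspace of `L⁰`. -/
def varLpSubmodule (p : ℝ → ℝ) (hp : Measurable p) (hp1 : ∀ t, 1 ≤ p t)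
    (hb : EssBoundedToRight p) : Submodule ℝ LZero where
  carrier := VarLp p
  zero_mem' := mem_varLp_iff.2
    (((SolutionBound.zero hp1).congr AEEqFun.coeFn_zero.symm).odeENorm_lt_top hp1)
  add_mem' {f g} hf hg := mem_varLp_iff.2
    ((((solutionBound_toReal hp1 (mem_varLp_iff.1 hf)).add
      (solutionBound_toReal hp1 (mem_varLp_iff.1 hg)) hp hp1 hb f.measurable
      g.measurable).congr (AEEqFun.coeFn_add f g).symm).odeENorm_lt_top hp1)
  smul_mem' c f hf := mem_varLp_iff.2
    ((((solutionBound_toReal hp1 (mem_varLp_iff.1 hf)).smul hp1 c).congr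
      (AEEqFun.coeFn_smul c f).symm).odeENorm_lt_top hp1)

variable {hp : Measurable p} {hp1 : ∀ t, 1 ≤ p t} {hb : EssBoundedToRight p}

lemma solutionBound_coe (f : varLpSubmodule p hp hp1 hb) :
    SolutionBound p (f : LZero) (odeENorm p (f : LZero)).toReal :=
  solutionBound_toReal hp1 (mem_varLp_iff.1 f.2)

lemma toReal_odeENorm_smul_le (c : ℝ) (f : varLpSubmodule p hp hp1 hb) :
    (odeENorm p ((c • f : varLpSubmodule p hp hp1 hb) : LZero)).toReal ≤
      |c| * (odeENorm p (f : LZero)).toReal :=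
  (((solutionBound_coe f).smul hp1 c).congr
    (AEEqFun.coeFn_smul c (f : LZero)).symm).toReal_odeENorm_le hp1

theorem isBanachNorm_odeENorm (hp : Measurable p) (hp1 : ∀ t, 1 ≤ p t)
    (hb : EssBoundedToRight p) : IsBanachNorm
      (fun f : varLpSubmodule p hp hp1 hb => (odeENorm p (f : LZero)).toReal) := by
  let V := varLpSubmodule p hp hp1 hb
  let : Norm V := ⟨fun f => (odeENorm p (f : LZero)).toReal⟩
  have hnorm : ∀ f : V, ‖f‖ = (odeENorm p (f : LZero)).toReal := fun _ => rfl
  have core : NormedSpace.Core ℝ V :=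
    { norm_nonneg := fun f => ENNReal.toReal_nonneg
      norm_smul := fun c f => by
        refine le_antisymm (toReal_odeENorm_smul_le c f) ?_
        rcases eq_or_ne c 0 with rfl | hc
        · rw [norm_zero, zero_mul]
          exact ENNReal.toReal_nonneg
        -- The reverse inequality is the direct one for the scalar c⁻¹ and the vector c • f.
        · have h1 := toReal_odeENorm_smul_le c⁻¹ (c • f)
          rw [inv_smul_smul₀ hc, abs_inv, ← div_eq_inv_mul, le_div_iff₀ (abs_pos.2 hc),
            mul_comm] at h1
          exact h1
      norm_triangle := fun f g =>
        (((solutionBound_coe f).add (solutionBound_coe g) hp hp1 hb (f : LZero).measurable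
          (g : LZero).measurable).congr
            (AEEqFun.coeFn_add (f : LZero) g).symm).toReal_odeENorm_le hp1
      norm_eq_zero_iff := fun f => by
        constructor
        · intro h
          have h1 := solutionBound_coe f
          rw [← hnorm, h] at h1
          exact Subtype.ext (AEEqFun.ext ((h1.ae_eq_zero hp1).trans AEEqFun.coeFn_zero.symm))
        · rintro rfl
          exact le_antisymm (((SolutionBound.zero hp1).congr
            AEEqFun.coeFn_zero.symm).toReal_odeENorm_le hp1) ENNReal.toReal_nonneg }
  refine ⟨core, ?_⟩
  let : NormedAddCommGroup V := NormedAddCommGroup.ofCore core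
  change CompleteSpace V
  refine NormedAddCommGroup.completeSpace_of_summable_imp_tendsto fun u hu => ?_
  obtain ⟨f, hf, hfK⟩ := exists_sum_solutionBound hp hp1 hb
    (U := fun k => ((u k : LZero) : ℝ → ℝ)) (fun k => (u k : LZero).measurable) hu
    fun k => solutionBound_coe (u k)
  let f' : LZero := AEEqFun.mk f hf.aestronglyMeasurable
  have hf' : f' =ᵐ[unitMeasure] f := AEEqFun.coeFn_mk f _
  have hrem : ∀ K, SolutionBound p (((∑ k ∈ Finset.range K, u k : V) : LZero) - f' : LZero)
      (∑' k, ‖u (k + K)‖) := fun K => by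
    refine (hfK K).congr ?_
    have h1 := AEEqFun.coeFn_finsetSum (Finset.range K) fun k => (u k : LZero)
    have h2 := AEEqFun.coeFn_sub ((∑ k ∈ Finset.range K, u k : V) : LZero) f'
    rw [Submodule.coe_sum] at h2 ⊢
    filter_upwards [h1, h2, hf'] with t h1 h2 h3
    rw [h2, Pi.sub_apply, h1, h3, Finset.sum_apply]
  have hfV : f' ∈ V := by
    have h0 : ((∑ k ∈ Finset.range 0, u k : V) : LZero) - f' ∈ V :=
      mem_varLp_iff.2 ((hrem 0).odeENorm_lt_top hp1)
    simpa using h0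
  refine ⟨⟨f', hfV⟩, tendsto_iff_norm_sub_tendsto_zero.2 ?_⟩
  exact squeeze_zero (fun _ => norm_nonneg _) (fun K => (hrem K).toReal_odeENorm_le hp1)
    (tendsto_sum_nat_add fun k => ‖u k‖)

end Norm

/-! ### Change of exponent on null sets, and the covering of [0,1) -/

section Exponent

variable {p p' f f' φ : ℝ → ℝ}

lemma IsStabilizedSolution.congr (h : IsStabilizedSolution p f φ) (hp : p =ᵐ[unitMeasure] p')
    (hf : f =ᵐ[unitMeasure] f') : IsStabilizedSolution p' f' φ := by
  obtain ⟨⟨ψ, hψ, hlim⟩, h0⟩ := h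
  exact ⟨⟨ψ, fun a ha => (hψ a ha).congr hp hf, hlim⟩, h0.congr hp hf⟩

lemma isStabilizedSolution_congr (hp : p =ᵐ[unitMeasure] p') (hf : f =ᵐ[unitMeasure] f') :
    IsStabilizedSolution p f = IsStabilizedSolution p' f' :=
  funext fun _ => propext ⟨fun h => h.congr hp hf, fun h => h.congr hp.symm hf.symm⟩

lemma odeENorm_congr (hp : p =ᵐ[unitMeasure] p') (hf : f =ᵐ[unitMeasure] f') :
    odeENorm p f = odeENorm p' f' := by
  rw [odeENorm, odeENorm, isStabilizedSolution_congr hp hf]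

lemma extENorm_congr (hp : p =ᵐ[unitMeasure] p') : extENorm p f = extENorm p' f := by
  refine iSup_congr fun n => odeENorm_congr hp ?_
  filter_upwards [hp] with t ht
  simp only [indicator_apply, mem_ofPred_eq, ht]

lemma varLp_congr (hp : p =ᵐ[unitMeasure] p') : VarLp p = VarLp p' := by
  unfold VarLp
  simp_rw [isStabilizedSolution_congr hp EventuallyEq.rfl]

lemma varLpExt_congr (hp : p =ᵐ[unitMeasure] p') : VarLpExt p = VarLpExt p' := by
  unfold VarLpExt
  simp_rw [extENorm_congr hp]

lemma EssBoundedToRight.congr (h : EssBoundedToRight p) (hp : p =ᵐ[unitMeasure] p') :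
    EssBoundedToRight p' := by
  intro T hT
  obtain ⟨β, hβ, C, hC⟩ := h T hT
  refine ⟨β, hβ, C, ?_⟩
  have h1 : p =ᵐ[volume.restrict (Ioo T β)] p' := ae_mono (Measure.restrict_mono
    (show Ioo T β ⊆ Icc (0 : ℝ) 1 from fun r hr => ⟨hT.1.trans hr.1.le, hr.2.le.trans hβ.2⟩)
    le_rfl) hp
  filter_upwards [hC, h1] with t h2 h3
  rwa [← h3]

/-- A well-ordered chain of intervals of full measure covers `[0,1)` by half-open intervals. -/
lemma exists_mem_Ico_of_wellOrdered {Γ : Set (Set ℝ)}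
    (hI : ∀ I ∈ Γ, ∃ a b : ℝ, 0 ≤ a ∧ a < b ∧ b ≤ 1 ∧ I = Ioo a b)
    (hfull : volume (⋃₀ Γ) = 1)
    (hw : ∀ Γ₀ ⊆ Γ, (sSup (⋃₀ Γ₀) < 1 ∨ sSup (⋃₀ Γ₀) = 0) → ∃ I ∈ Γ, sInf I = sSup (⋃₀ Γ₀))
    {T : ℝ} (hT : T ∈ Ico (0 : ℝ) 1) :
    ∃ a b : ℝ, T ∈ Ico a b ∧ b ≤ 1 ∧ Ioo a b ∈ Γ := by
  by_contra! hcon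
  have hopen : IsOpen (⋃₀ Γ) := isOpen_sUnion fun I hIΓ => by
    obtain ⟨a, b, -, -, -, rfl⟩ := hI I hIΓ
    exact isOpen_Ioo
  have hsub : ⋃₀ Γ ⊆ Icc 0 1 := sUnion_subset fun I hIΓ => by
    obtain ⟨a, b, ha, -, hb, rfl⟩ := hI I hIΓ
    exact fun t ht => ⟨ha.trans ht.1.le, ht.2.le.trans hb⟩
  -- Suppose no [a,b) contains T. An interval of Γ meeting the gap between the supremum of ⋃Γ₀ and T
  -- would end beyond T and so contain T; hence the gap misses ⋃Γ and, by full measure, is empty.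
  -- The order condition then gives an interval starting at T, a contradiction.
  let Γ₀ := {I ∈ Γ | I ⊆ Iic T}
  have hle : ∀ t ∈ ⋃₀ Γ₀, t ≤ T := by
    rintro t ⟨I, hI0, htI⟩
    exact hI0.2 htI
  have hnn : ∀ t ∈ ⋃₀ Γ₀, 0 ≤ t := by
    rintro t ⟨I, hI0, htI⟩
    exact (hsub ⟨I, hI0.1, htI⟩).1
  have hs0 : 0 ≤ sSup (⋃₀ Γ₀) := Real.sSup_nonneg hnn
  have hsT : sSup (⋃₀ Γ₀) ≤ T := Real.sSup_le hle hT.1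
  have hsup : sSup (⋃₀ Γ₀) = T := by
    refine hsT.eq_of_not_lt fun hlt => ?_
    have hdisj : Ioo (sSup (⋃₀ Γ₀)) T ⊆ Icc 0 1 \ ⋃₀ Γ := by
      intro t ht
      refine ⟨⟨hs0.trans ht.1.le, ht.2.le.trans hT.2.le⟩, ?_⟩
      rintro ⟨I, hIΓ, htI⟩
      obtain ⟨a, b, ha, -, hb, rfl⟩ := hI I hIΓ
      rcases le_or_gt b T with hbT | hbT
      · have : t ∈ ⋃₀ Γ₀ := ⟨_, ⟨hIΓ, fun r hr => hr.2.le.trans hbT⟩, htI⟩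
        exact absurd (le_csSup ⟨T, hle⟩ this) (not_le.2 ht.1)
      · exact hcon a b ⟨htI.1.le.trans ht.2.le, hbT⟩ hb hIΓ
    have h0 : volume (Icc (0 : ℝ) 1 \ ⋃₀ Γ) = 0 := by
      rw [measure_sdiff hsub hopen.measurableSet.nullMeasurableSet (by simp [hfull]), hfull]
      simp
    have h1 := measure_mono_null hdisj h0
    rw [Real.volume_Ioo, ENNReal.ofReal_eq_zero] at h1
    linarith
  obtain ⟨I, hIΓ, hinf⟩ := hw Γ₀ (sep_subset _ _) (Or.inl (hsup ▸ hT.2))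
  obtain ⟨a, b, ha, hab, hb, rfl⟩ := hI I hIΓ
  rw [csInf_Ioo hab, hsup] at hinf
  exact hcon a b ⟨hinf.le, hinf ▸ hab⟩ hb hIΓ

end Exponent

end

theorem theorem1p3 (p : ℝ → ℝ)
    (hp_meas : AEMeasurable p unitMeasure)
    (hp_one : ∀ᵐ t ∂unitMeasure, 1 ≤ p t)
    (Γ : Set (Set ℝ))
    (hΓ_interval : ∀ I ∈ Γ, ∃ a b : ℝ, 0 ≤ a ∧ a < b ∧ b ≤ 1 ∧ I = Ioo a b)
    (hΓ_disjoint : Γ.PairwiseDisjoint id)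
    (hΓ_bounded : ∀ I ∈ Γ, ∃ C : ℝ, ∀ᵐ t ∂(volume.restrict I), |p t| ≤ C)
    (hΓ_full : volume (⋃₀ Γ) = 1)
    -- in `ℝ` the supremum of the empty set is `0`, as it is in `[0,1]`
    (hΓ_wellOrdered : ∀ Γ₀ ⊆ Γ, (sSup (⋃₀ Γ₀) < 1 ∨ sSup (⋃₀ Γ₀) = 0) →
      ∃ I ∈ Γ, sInf I = sSup (⋃₀ Γ₀)) :
    VarLp p = VarLpExt p ∧
    (∀ f ∈ VarLp p, odeENorm p f = extENorm p f) ∧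
    ∃ V : Submodule ℝ LZero, (V : Set LZero) = VarLp p ∧
      IsBanachNorm (fun f : V => (odeENorm p (f : LZero)).toReal) := by
  have hb : EssBoundedToRight p := by
    intro T hT
    obtain ⟨a, b, hab, hb1, hIΓ⟩ :=
      exists_mem_Ico_of_wellOrdered hΓ_interval hΓ_full hΓ_wellOrdered hT
    obtain ⟨C, hC⟩ := hΓ_bounded _ hIΓ
    refine ⟨b, ⟨hab.2, hb1⟩, C, ae_mono (Measure.restrict_mono
      (Ioo_subset_Ioo_left hab.1) le_rfl) ?_⟩
    filter_upwards [hC] with t ht using (le_abs_self _).trans ht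
  -- All notions depend only on the a.e. class of p, so p may be replaced by a measurable exponent
  -- that is at least 1 everywhere, as the lemmas require.
  obtain ⟨q, hq, hq1, hpq⟩ : ∃ q : ℝ → ℝ, Measurable q ∧ (∀ t, 1 ≤ q t) ∧ p =ᵐ[unitMeasure] q := by
    refine ⟨fun t => max (hp_meas.mk p t) 1, hp_meas.measurable_mk.max measurable_const,
      fun t => le_max_right _ _, ?_⟩
    filter_upwards [hp_meas.ae_eq_mk, hp_one] with t h1 h2
    rw [← h1, max_eq_left h2]
  have hbq := hb.congr hpq
  have heq : ∀ f : LZero, odeENorm q f = extENorm q f := fun f =>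
    odeENorm_eq_extENorm hq hq1 hbq f.measurable
  simp_rw [varLp_congr hpq, varLpExt_congr hpq, odeENorm_congr hpq EventuallyEq.rfl,
    extENorm_congr hpq]
  refine ⟨?_, fun f _ => heq f, varLpSubmodule q hq hq1 hbq, rfl, isBanachNorm_odeENorm hq hq1 hbq⟩
  ext f
  rw [mem_varLp_iff, heq]
  rfl
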